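/- Let $f:\,]0,\infty[\,\to\mathbb R$ be a $C^\infty$ function. *Flow.* Let $\Phi_f$ be the flow on $\mathbb C$ generated by the ODE $\dot z = i z f(|z|) - i$ on $\mathbb C\setminus\{0\}$; a solution that reaches $0$ in finite time passes through $0$ without resting there, and $0$ is a fixed point if and only if no solution reaches it. A point $z$ is periodic if $\Phi_f(t,z)=z$ for some $t>0$ (so fixed points are periodic), and then $T_f(z)=\inf\{t>0:\Phi_f(t,z)=z\}$. A periodic orbit $\Phi_f(\mathbb R,z)$ is untwisted if $0$ lies in its exterior, i.e. in the unbounded component of $\mathbb C\setminus\Phi_f(\mathbb R,z)$; otherwise it is twisted. The net winding of a periodic point $z$ is $$\omega_f(z)=\pm\frac1{2\pi}\int_0^{T_f(z)} f(|\Phi_f(t,z)|)\,dt ,$$ with the plus (minus) sign if the closed path $\Phi_f(\cdot,z)$ is oriented counter-clockwise (clockwise), and $\omega_f(z)=0$ if $z$ is a fixed point. *Curves.* An oriented smooth curve $\mathcal C$ is a $C^\infty$ path $c:J\to\mathbb C$ parametrized by arc length on an open interval $J\ni 0$, up to a shift of the parameter; $[\mathcal C]=c(J)$. Write $\dot c=e^{i\vartheta_c}$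 with $\vartheta_c:J\to\mathbb R$ smooth. The curve $\mathcal C$ is a solution of $\kappa=f(r)$ if $\dot\vartheta_c(t)=f(|c(t)|)$ for all $t\in J$ with $c(t)\neq0$; the solution is maximal if $[\mathcal C]\subset[\widehat{\mathcal C}]$ for a solution $\widehat{\mathcal C}$ implies $[\mathcal C]=[\widehat{\mathcal C}]$. A Jordan solution is a maximal solution for which $[\mathcal C]$ is homeomorphic to the unit circle. Let $z_c(0)=-i\,\overline{c(0)}\,e^{i\vartheta_c(0)}$. *Statement.* Let $\mathcal C$ be a Jordan solution of $\kappa=f(r)$, and $c$ any of its parametrizations. Then $z_c(0)$ is a periodic point of $\Phi_f$, the integral defining $\omega_f(z_c(0))$ exists, and, calling $\mathcal C$ (un)twisted if $\Phi_f(\mathbb R,z_c(0))$ is (un)twisted and putting $\omega_f(\mathcal C)=\omega_f(z_c(0))$: (i) if $\mathcal C$ is untwisted, then $\omega_f(\mathcal C)=0$ or $\omega_f(\mathcal C)=1/n$ for some integer $n\ge1$; (ii) if $\mathcal C$ is twisted, then $\omega_f(\mathcal C)=1$. -/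

import Mathlib

open scoped ContDiff

namespace CurvatureODE

/-! ### The planar flow `ż = i z f(|z|) - i` -/

/-- The vector field `z ↦ i z f(|z|) - i`, relevant for `z ≠ 0` only. -/
noncomputable def field (f : ℝ → ℝ) (z : ℂ) : ℂ :=
  Complex.I * z * (f ‖z‖ : ℂ) - Complex.I

/-- A global flow line that does not rest at `0`: a continuous path in `ℂ` that solves
`ż = i z f(|z|) - i` at all times at which it is not at the origin, and that is at the origin
on no time interval of positive length. It may pass through the origin. -/
structure IsFlowLine (f : ℝ → ℝ) (ζ : ℝ → ℂ) : Prop where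
  continuous : Continuous ζ
  hasDerivAt : ∀ t : ℝ, ζ t ≠ 0 → HasDerivAt ζ (field f (ζ t)) t
  dense : Dense {t : ℝ | ζ t ≠ 0}

/-- The flow `Φ_f` on `ℂ` generated by `ż = i z f(|z|) - i`. The ODE lives on `ℂ \ {0}`; a
solution that reaches `0` in finite time passes through `0` without resting there, and continues
as a solution of the ODE. For smooth `f` there is exactly one such line through each `p ≠ 0`. If
there is one through `0`, it is unique as well, and it is the orbit of `0`; otherwise no
solution reaches `0`, and `0` is a fixed point. Since the time-`t` maps of a flow are one-to-one,
this is the only way to extend the local flow of the ODE on `ℂ \ {0}` to a flow on `ℂ`. -/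
noncomputable def flow (f : ℝ → ℝ) (t : ℝ) (p : ℂ) : ℂ :=
  open Classical in
  if h : ∃ ζ : ℝ → ℂ, IsFlowLine f ζ ∧ ζ 0 = p then h.choose t else p

/-- The orbit `Φ_f(ℝ, z)`. -/
def orbit (f : ℝ → ℝ) (z : ℂ) : Set ℂ := Set.range fun t : ℝ => flow f t z

/-- `z ∈ Per Φ_f`; fixed points are periodic. -/
def IsPeriodic (f : ℝ → ℝ) (z : ℂ) : Prop := ∃ t : ℝ, 0 < t ∧ flow f t z = z

/-- `T_f(z) = inf {t > 0 : Φ_f(t, z) = z}`, for periodic `z`; it is `0` at fixed points. -/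
noncomputable def period (f : ℝ → ℝ) (z : ℂ) : ℝ := sInf {t : ℝ | 0 < t ∧ flow f t z = z}

/-- `0` lies in the exterior of the orbit of `z`, i.e. in the unbounded component of its
complement. (If `0` is on the orbit, the component below is empty, by convention.) -/
def ZeroInExterior (f : ℝ → ℝ) (z : ℂ) : Prop :=
  ¬ Bornology.IsBounded (connectedComponentIn (orbit f z)ᶜ 0)

/-- The orbit of `z` is periodic, with `0` in its exterior. -/
def OrbitUntwisted (f : ℝ → ℝ) (z : ℂ) : Prop := IsPeriodic f z ∧ ZeroInExterior f z

/-- The orbit of `z` is periodic, with `0` not in its exterior. -/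
def OrbitTwisted (f : ℝ → ℝ) (z : ℂ) : Prop := IsPeriodic f z ∧ ¬ ZeroInExterior f z

/-- The path `γ` on `[0, T]`, closed and not through `w`, has winding number `k` around `w`:
its argument as seen from `w` grows by `2πk`. -/
def HasWindingNumber (γ : ℝ → ℂ) (T : ℝ) (w : ℂ) (k : ℤ) : Prop :=
  γ T = γ 0 ∧ (∀ t ∈ Set.Icc 0 T, γ t ≠ w) ∧
    ∃ θ : ℝ → ℝ, ContinuousOn θ (Set.Icc 0 T) ∧
      (∀ t ∈ Set.Icc 0 T, γ t - w = (‖γ t - w‖ : ℂ) * Complex.exp (Complex.I * (θ t : ℂ))) ∧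
      θ T - θ 0 = 2 * Real.pi * (k : ℝ)

/-- The simple closed path `t ↦ Φ_f(t, z)`, `0 ≤ t ≤ T_f(z)`, is oriented counter-clockwise: it
has winding number `1` around some point (hence around every point of its interior). If
it is oriented clockwise, all its winding numbers are `0` or `-1`. -/
def IsCounterclockwise (f : ℝ → ℝ) (z : ℂ) : Prop :=
  ∃ w : ℂ, HasWindingNumber (fun t => flow f t z) (period f z) w 1

/-- The net winding `ω_f(z) = ± (1 / 2π) ∫₀^{T_f(z)} f(|Φ_f(t, z)|) dt`, with the plus sign for
counter-clockwise and the minus sign for clockwise orientation. It is `0` at fixed points, where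
`T_f(z) = 0`. -/
noncomputable def netWinding (f : ℝ → ℝ) (z : ℂ) : ℝ :=
  open Classical in
  (if IsCounterclockwise f z then 1 else -1) *
    (1 / (2 * Real.pi) * ∫ t in (0 : ℝ)..period f z, f ‖flow f t z‖)

/-! ### Curves with prescribed curvature `κ = f(r)` -/

/-- A smooth path parametrized by arc length on an open interval that contains `0`. An oriented
smooth curve is a class of such paths modulo a shift of the parameter; it is given here through
an arbitrary representative. Values of `toFun` outside `dom` play no role. -/
structure ArcPath where
  dom : Set ℝ
  toFun : ℝ → ℂ
  isOpen_dom : IsOpen dom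
  ordConnected_dom : dom.OrdConnected
  zero_mem : (0 : ℝ) ∈ dom
  smooth : ContDiffOn ℝ ∞ toFun dom
  unit_speed : ∀ t ∈ dom, ‖deriv toFun t‖ = 1

namespace ArcPath

/-- The set `[𝒞]` of points of the curve. -/
def trace (c : ArcPath) : Set ℂ := c.toFun '' c.dom

/-- `ϑ` is a smooth tangent angle: `ċ = exp(iϑ)`. -/
def IsTangentAngle (c : ArcPath) (θ : ℝ → ℝ) : Prop :=
  ContDiffOn ℝ ∞ θ c.dom ∧
    ∀ t ∈ c.dom, deriv c.toFun t = Complex.exp (Complex.I * (θ t : ℂ))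

/-- The curve solves `κ = f(r)`: its curvature, the derivative of a tangent angle, equals
`f(|c(t)|)` whenever `c(t) ≠ 0`. -/
def IsSolution (f : ℝ → ℝ) (c : ArcPath) : Prop :=
  ∃ θ : ℝ → ℝ, c.IsTangentAngle θ ∧ ∀ t ∈ c.dom, c.toFun t ≠ 0 → deriv θ t = f ‖c.toFun t‖

/-- A maximal solution: one whose point set cannot be enlarged. -/
def IsMaximalSolution (f : ℝ → ℝ) (c : ArcPath) : Prop :=
  IsSolution f c ∧
    ∀ d : ArcPath, IsSolution f d → c.trace ⊆ d.trace → c.trace = d.trace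

/-- A simple closed curve: the point set is homeomorphic to the unit circle. -/
def IsSimpleClosed (c : ArcPath) : Prop := Nonempty (c.trace ≃ₜ Circle)

/-- A Jordan solution of `κ = f(r)`. -/
def IsJordanSolution (f : ℝ → ℝ) (c : ArcPath) : Prop :=
  IsMaximalSolution f c ∧ c.IsSimpleClosed

/-- `z_c(0) = -i conj(c(0)) exp(iϑ_c(0))`, where `exp(iϑ_c) = ċ`. -/
noncomputable def basePoint (c : ArcPath) : ℂ :=
  -Complex.I * (starRingEnd ℂ) (c.toFun 0) * deriv c.toFun 0

/-- The curve is untwisted: the orbit of `z_c(0)` is. -/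
def IsUntwisted (f : ℝ → ℝ) (c : ArcPath) : Prop := OrbitUntwisted f c.basePoint

/-- The curve is twisted: the orbit of `z_c(0)` is. -/
def IsTwisted (f : ℝ → ℝ) (c : ArcPath) : Prop := OrbitTwisted f c.basePoint

/-- The net winding of the curve. -/
noncomputable def omega (f : ℝ → ℝ) (c : ArcPath) : ℝ := netWinding f c.basePoint

end ArcPath

end CurvatureODE

/-!
The point `z = -i conj(c) ċ`, the position of the origin in the frame that moves along a curve, up
to a reflection, solves `ż = i z κ - i`. For a solution `c` of `κ = f(r)` it therefore runs along an
orbit of the flow, and `c` is recovered from `z` and the tangent angle `θ` as `-i conj(z) exp(iθ)`.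

*Closing up.* The parametrization of a Jordan solution, followed by a homeomorphism to the circle,
lifts to a strictly increasing angle, which must exceed a full turn. Points one turn apart have the
same image, and by arc length they are a constant time `L` apart. So `c` extends to an
`L`-periodic solution on the line (`ArcPath.exists_isClosedSolution`).

*Uniqueness.* Off the origin the field is locally Lipschitz. If `c` passes through the origin, then
`f(r)` near `r = 0` is the curvature at the time at which `|c| = r`, so `f` is Lipschitz there, and
a flow line that meets the origin solves the ODE also at that time. Hence the flow line through
`z(0)` is `z` (`IsGlobalSolution.flow_movingPath`).

*Shape of the orbit.* Unless `z` is constant, which makes `c` a circle about the origin, it has a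
minimal period `T` with `L = nT`. The flow is reversible under complex conjugation, and
`d|z|²/dt = -2 Im z`. Started at a point farthest from the origin, the orbit is therefore symmetric,
real only at multiples of `T / 2`, and runs through the upper half-plane with decreasing `|z|`
(`IsGlobalSolution.isOval`). So the sign `σ` of the farthest point is its orientation
(`IsOval.isWinding_of_between`, `IsOval.not_isWinding_one`).

*Untwisted and twisted.* Let `α` be the integral of `κ` over the time `T`. Over this time the curve
is rotated by `α` about the origin, so `nα` is its total turning, which is `2πσ` by Hopf's
Umlaufsatz (`IsSimpleLoop.rotation_eq`); hence the net winding is `σα / 2π = 1 / n`. If `n > 1`, then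
the chord from `c(t)` to `c(t + T)` is `(exp(iα) - 1) c(t)`. In particular `c` avoids the origin. By
continuity of the secant angle the argument of the chord, hence of `c`, grows by `α` over the time
`T`, as much as `θ` (`IsSimpleLoop.arg_add_of_symmetric`). Hence the argument of `z` does not grow,
and `z` does not wind around the origin, as it would if it were twisted. So `n = 1` in the twisted
case.
-/

namespace CurvatureODE

/-! ### Continuous arguments -/

/-- `ψ` is a continuous argument of `g` on `U`. At zeros of `g` the second condition is void. -/
def IsArgOn {X : Type*} [TopologicalSpace X] (g : X → ℂ) (ψ : X → ℝ) (U : Set X) : Prop :=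
  ContinuousOn ψ U ∧ ∀ x ∈ U, g x = (‖g x‖ : ℂ) * Complex.exp (Complex.I * (ψ x : ℂ))

theorem IsArgOn.mono {X : Type*} [TopologicalSpace X] {g : X → ℂ} {ψ : X → ℝ} {U V : Set X}
    (h : IsArgOn g ψ U) (hV : V ⊆ U) : IsArgOn g ψ V :=
  ⟨h.1.mono hV, fun x hx => h.2 x (hV hx)⟩

theorem norm_exp_I_mul (x : ℝ) : ‖Complex.exp (Complex.I * (x : ℂ))‖ = 1 := by
  rw [mul_comm]; exact Complex.norm_exp_ofReal_mul_I x

/-- Dividing out the norm: the polar direction of a nonzero number is unchanged by a positive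
factor. -/
theorem exp_arg_eq {a b : ℂ} {ψ χ ρ β : ℝ} (ha : a ≠ 0)
    (hψ : a = (‖a‖ : ℂ) * Complex.exp (Complex.I * (ψ : ℂ)))
    (hχ : b = (‖b‖ : ℂ) * Complex.exp (Complex.I * (χ : ℂ))) (hρ : 0 < ρ)
    (hab : a = (ρ : ℂ) * Complex.exp (Complex.I * (β : ℂ)) * b) :
    Complex.exp (Complex.I * (ψ : ℂ)) = Complex.exp (Complex.I * ((χ + β : ℝ) : ℂ)) := by
  have hn : ‖a‖ = ρ * ‖b‖ := by
    have := congrArg norm hab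
    rwa [norm_mul, norm_mul, norm_exp_I_mul, mul_one, Complex.norm_real, Real.norm_eq_abs,
      abs_of_pos hρ] at this
  have ha' : (‖a‖ : ℂ) ≠ 0 := by exact_mod_cast norm_ne_zero_iff.2 ha
  apply mul_left_cancel₀ ha'
  rw [← hψ]
  nth_rewrite 1 [hab]
  nth_rewrite 1 [hχ]
  rw [hn]
  push_cast
  rw [mul_add, Complex.exp_add]
  ring

theorem exp_I_mul_eq_iff {x y : ℝ} :
    Complex.exp (Complex.I * (x : ℂ)) = Complex.exp (Complex.I * (y : ℂ)) ↔
      ∃ k : ℤ, x = y + 2 * Real.pi * k := by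
  rw [Complex.exp_eq_exp_iff_exists_int]
  refine exists_congr fun k => ⟨fun h => ?_, fun h => ?_⟩
  · have := congrArg Complex.im h
    simp at this
    linarith
  · rw [h]; push_cast; ring

/-- A continuous integer-valued function on a connected set is constant, in the form in which
arguments are compared. -/
theorem exists_int_of_forall_exists_int {X : Type*} [TopologicalSpace X] {U : Set X}
    (hU : IsPreconnected U) {ψ χ : X → ℝ} (hψ : ContinuousOn ψ U) (hχ : ContinuousOn χ U) {β : ℝ}
    (h : ∀ x ∈ U, ∃ k : ℤ, ψ x = χ x + β + 2 * Real.pi * k) :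
    ∃ k : ℤ, ∀ x ∈ U, ψ x = χ x + β + 2 * Real.pi * k := by
  have hpi := Real.pi_pos
  have hd : IsDiscrete (Set.range ((↑) : ℤ → ℝ)) :=
    Int.isClosedEmbedding_coe_real.isInducing.isDiscrete_range
  obtain ⟨y, ⟨k, rfl⟩, hy⟩ := hU.eqOn_const_of_mapsTo (T := Set.range ((↑) : ℤ → ℝ))
    (f := fun x => (ψ x - χ x - β) / (2 * Real.pi)) hd (((hψ.sub hχ).sub continuousOn_const).div_const _)
    (fun x hx => by
      obtain ⟨k, hk⟩ := h x hx
      exact ⟨k, by simp only; rw [hk]; field_simp; ring⟩) ⟨_, 0, rfl⟩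
  refine ⟨k, fun x hx => ?_⟩
  have := hy hx
  simp only [Function.const_apply] at this
  rw [div_eq_iff (by positivity)] at this
  linarith

/-- Continuous arguments of two functions that differ by a positive factor and a fixed rotation
differ by a constant on connected sets. -/
theorem IsArgOn.sub_const {X : Type*} [TopologicalSpace X] {U : Set X} (hU : IsPreconnected U)
    {g h : X → ℂ} {ψ χ : X → ℝ} (hg : IsArgOn g ψ U) (hh : IsArgOn h χ U) {β : ℝ} (ρ : X → ℝ)
    (h0 : ∀ x ∈ U, g x ≠ 0) (hρ : ∀ x ∈ U, 0 < ρ x)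
    (hgh : ∀ x ∈ U, g x = (ρ x : ℂ) * Complex.exp (Complex.I * (β : ℂ)) * h x) :
    ∃ k : ℤ, ∀ x ∈ U, ψ x = χ x + β + 2 * Real.pi * k :=
  exists_int_of_forall_exists_int hU hg.1 hh.1 fun x hx =>
    exp_I_mul_eq_iff.1 (exp_arg_eq (h0 x hx) (hg.2 x hx) (hh.2 x hx) (hρ x hx) (hgh x hx))

theorem exists_isArgOn {E : Type*} [NormedAddCommGroup E] [NormedSpace ℝ E] {U : Set E}
    (hc : Convex ℝ U) (ho : IsOpen U) (hne : U.Nonempty) {g : E → ℂ} (hg : ContinuousOn g U)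
    (h0 : ∀ x ∈ U, g x ≠ 0) : ∃ ψ : E → ℝ, IsArgOn g ψ U := by
  have : ContractibleSpace U := hc.contractibleSpace hne
  have hs : IsSimplyConnected U := inferInstanceAs (SimplyConnectedSpace U)
  obtain ⟨F, hF, hFg⟩ := Complex.exists_continuousOn_eqOn_exp_comp hs ho hg
    (by rintro ⟨x, hx, hx0⟩; exact h0 x hx hx0)
  refine ⟨fun x => (F x).im, Complex.continuous_im.comp_continuousOn hF, fun x hx => ?_⟩
  have h1 : Complex.exp (F x) = g x := hFg hx
  rw [← h1, Complex.norm_exp, Complex.ofReal_exp, ← Complex.exp_add]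
  congr 1
  nth_rewrite 1 [← Complex.re_add_im (F x)]
  ring

/-- A continuous argument of a periodic function grows by a fixed multiple of `2π` per period. -/
theorem IsArgOn.add_period {g : ℝ → ℂ} {ψ : ℝ → ℝ} (h : IsArgOn g ψ Set.univ) {T : ℝ}
    (hT : Function.Periodic g T) (h0 : ∀ t, g t ≠ 0) :
    ∃ k : ℤ, ∀ t, ψ (t + T) = ψ t + 2 * Real.pi * k := by
  have hs : IsArgOn g (fun t => ψ (t + T)) Set.univ :=
    ⟨(h.1.comp (by fun_prop) (fun _ _ => Set.mem_univ _) :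
        ContinuousOn (ψ ∘ fun t => t + T) Set.univ),
      fun t _ => by have := h.2 (t + T) trivial; rwa [hT t] at this⟩
  obtain ⟨k, hk⟩ := IsArgOn.sub_const isPreconnected_univ hs h (β := 0) (fun _ => 1)
    (fun t _ => h0 t) (fun _ _ => one_pos) (fun t _ => by simp)
  exact ⟨k, fun t => by simpa using hk t trivial⟩

/-- The argument of a real number `x`, seen through its sign `ε`. -/
theorem exp_arg_real {x ε ψ : ℝ} (hε : 0 < ε * x) (hε1 : ε * ε = 1)
    (hψ : (x : ℂ) = (‖(x : ℂ)‖ : ℂ) * Complex.exp (Complex.I * (ψ : ℂ))) :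
    Complex.exp (Complex.I * (ψ : ℂ)) = (ε : ℂ) := by
  have hx : |x| = ε * x := by
    rcases mul_self_eq_one_iff.1 hε1 with rfl | rfl
    · rw [one_mul] at hε ⊢; exact abs_of_pos hε
    · rw [neg_one_mul] at hε ⊢; exact abs_of_neg (by linarith)
  have hx0 : (x : ℂ) ≠ 0 := by
    intro h0
    rw [Complex.ofReal_eq_zero] at h0
    rw [h0, mul_zero] at hε
    exact lt_irrefl _ hε
  rw [Complex.norm_real, Real.norm_eq_abs, hx] at hψ
  have he : (ε : ℂ) * ε = 1 := by exact_mod_cast hε1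
  apply mul_left_cancel₀ hx0
  push_cast at hψ
  linear_combination (-ε : ℂ) * hψ - (x : ℂ) * Complex.exp (Complex.I * ψ) * he

/-- A quantity that moves continuously from `0` to an odd multiple of `π` with nonnegative sine
ends at `π`. -/
theorem eq_one_of_sin_nonneg {Y : ℝ → ℝ} {a : ℝ} (ha : 0 ≤ a) (hY : ContinuousOn Y (Set.Icc 0 a))
    (hs : ∀ t ∈ Set.Icc 0 a, 0 ≤ Real.sin (Y t)) (h0 : Y 0 = 0) {k : ℤ} (hk : Odd k)
    (h1 : Y a = Real.pi * k) : k = 1 := by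
  have hpi := Real.pi_pos
  by_contra hne
  rcases lt_or_ge k 1 with hlt | hge
  · have hk1 : k ≤ -1 := by
      obtain ⟨m, rfl⟩ := hk
      omega
    have hk1' : (k : ℝ) ≤ -1 := by exact_mod_cast hk1
    obtain ⟨t, ht, hYt⟩ := intermediate_value_Icc' ha hY
      (show -(Real.pi / 2) ∈ Set.Icc (Y a) (Y 0) from ⟨by rw [h1]; nlinarith, by rw [h0]; linarith⟩)
    have := hs t ht
    rw [hYt, Real.sin_neg, Real.sin_pi_div_two] at this
    linarith
  · have hk3 : 3 ≤ k := by
      obtain ⟨m, rfl⟩ := hk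
      omega
    have hk3' : (3 : ℝ) ≤ k := by exact_mod_cast hk3
    obtain ⟨t, ht, hYt⟩ := intermediate_value_Icc ha hY
      (show Real.pi / 2 + Real.pi ∈ Set.Icc (Y 0) (Y a) from
        ⟨by rw [h0]; linarith, by rw [h1]; nlinarith⟩)
    have := hs t ht
    rw [hYt, Real.sin_add_pi, Real.sin_pi_div_two] at this
    linarith

/-! ### The secant map and the rotation number of a simple closed curve -/

/-- A simple closed curve of length `L`, parametrized by arc length on the whole line, with
continuous tangent angle `θ`. -/
structure IsSimpleLoop (c : ℝ → ℂ) (θ : ℝ → ℝ) (L : ℝ) : Prop where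
  pos : 0 < L
  continuous_angle : Continuous θ
  hasDerivAt : ∀ t, HasDerivAt c (Complex.exp (Complex.I * (θ t : ℂ))) t
  periodic : Function.Periodic c L
  inj : ∀ s t, c s = c t → ∃ k : ℤ, t = s + k * L

/-- The secant map `(s, τ) ↦ (c(s + τ) - c(s)) / τ`, written as a mean of the velocity so that it
is continuous at `τ = 0`, where it is the velocity. -/
noncomputable def secant (θ : ℝ → ℝ) (p : ℝ × ℝ) : ℂ :=
  ∫ x in (0 : ℝ)..1, Complex.exp (Complex.I * (θ (p.1 + x * p.2) : ℂ))

/-- The strip `|τ| < L` on which the secant map of a simple closed curve has no zeros. -/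
def strip (L : ℝ) : Set (ℝ × ℝ) := {p | |p.2| < L}

theorem isOpen_strip (L : ℝ) : IsOpen (strip L) :=
  isOpen_lt (by fun_prop) continuous_const

theorem convex_strip (L : ℝ) : Convex ℝ (strip L) := by
  have : strip L = (LinearMap.snd ℝ ℝ ℝ) ⁻¹' (Set.Ioo (-L) L) := by
    ext p; simp [strip, abs_lt]
  rw [this]
  exact (convex_Ioo _ _).linear_preimage _

theorem secant_zero (θ : ℝ → ℝ) (s : ℝ) :
    secant θ (s, 0) = Complex.exp (Complex.I * (θ s : ℂ)) := by
  simp [secant]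

/-- If the tangent turns by `α` under the shift by `T`, then so do all secants. -/
theorem secant_add {θ : ℝ → ℝ} {T α : ℝ} (hT : ∀ s, θ (s + T) = θ s + α) (s τ : ℝ) :
    secant θ (s + T, τ) = Complex.exp (Complex.I * (α : ℂ)) * secant θ (s, τ) := by
  simp only [secant]
  rw [← intervalIntegral.integral_const_mul]
  congr 1
  ext x
  rw [show s + T + x * τ = s + x * τ + T by ring, hT, ← Complex.exp_add]
  push_cast
  ring_nf

/-- If the tangent turns by `α` under the shift by `T`, then so does the argument of all secants. -/
theorem IsArgOn.secant_shift {θ : ℝ → ℝ} {L T α : ℝ} {ψ : ℝ × ℝ → ℝ} (hL : 0 < L)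
    (hψ : IsArgOn (secant θ) ψ (strip L)) (h0 : ∀ p ∈ strip L, secant θ p ≠ 0)
    (hψ0 : ∀ s, ψ (s, 0) = θ s) (hT : ∀ s, θ (s + T) = θ s + α) {s τ : ℝ}
    (hτ : (s, τ) ∈ strip L) : ψ (s + T, τ) = ψ (s, τ) + α := by
  have hm : Set.MapsTo (fun p : ℝ × ℝ => (p.1 + T, p.2)) (strip L) (strip L) := fun p hp => hp
  have h1 : IsArgOn (fun p : ℝ × ℝ => secant θ (p.1 + T, p.2)) (fun p => ψ (p.1 + T, p.2))
      (strip L) := ⟨hψ.1.comp (by fun_prop) hm, fun p hp => hψ.2 _ (hm hp)⟩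
  obtain ⟨k, hk⟩ := IsArgOn.sub_const (convex_strip L).isPreconnected h1 hψ (β := α) (fun _ => 1)
    (fun p hp => h0 _ (hm hp)) (fun _ _ => one_pos)
    (fun p _ => by simp [secant_add hT])
  have hz := hk (0, 0) (by simpa [strip] using hL)
  simp only [hψ0, hT] at hz
  have := hk (s, τ) hτ
  simp only at this
  linarith

namespace IsSimpleLoop

variable {c : ℝ → ℂ} {θ : ℝ → ℝ} {L : ℝ}

theorem continuous_secant (h : IsSimpleLoop c θ L) : Continuous (secant θ) := by
  have := h.continuous_angle
  exact intervalIntegral.continuous_parametric_intervalIntegral_of_continuous' (by fun_prop) _ _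

theorem mul_secant (h : IsSimpleLoop c θ L) (s τ : ℝ) :
    (τ : ℂ) * secant θ (s, τ) = c (s + τ) - c s := by
  have hc := h.continuous_angle
  have hd : ∀ x ∈ Set.uIcc (0 : ℝ) 1, HasDerivAt (fun x : ℝ => c (s + x * τ))
      ((τ : ℂ) * Complex.exp (Complex.I * (θ (s + x * τ) : ℂ))) x := by
    intro x _
    have h1 : HasDerivAt (fun x : ℝ => s + x * τ) τ x := by
      simpa using ((hasDerivAt_id x).mul_const τ).const_add s
    simpa [Function.comp_def] using (h.hasDerivAt (s + x * τ)).scomp x h1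
  have := intervalIntegral.integral_eq_sub_of_hasDerivAt hd
    (Continuous.intervalIntegrable (by fun_prop) _ _)
  simp only [intervalIntegral.integral_const_mul] at this
  simpa [secant] using this

theorem secant_ne_zero (h : IsSimpleLoop c θ L) {p : ℝ × ℝ} (hp : p ∈ strip L) :
    secant θ p ≠ 0 := by
  obtain ⟨s, τ⟩ := p
  intro h0
  have hp' : |τ| < L := hp
  rcases eq_or_ne τ 0 with rfl | hτ
  · rw [secant_zero] at h0
    exact Complex.exp_ne_zero _ h0
  · have h1 := h.mul_secant s τ
    rw [h0, mul_zero] at h1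
    obtain ⟨k, hk⟩ := h.inj (s + τ) s (sub_eq_zero.1 h1.symm)
    have hk' : τ = -(k * L) := by linarith
    rw [hk', abs_neg, abs_mul, abs_of_pos h.pos] at hp'
    have h2 : |(k : ℝ)| < 1 := by
      by_contra hcon
      nlinarith [h.pos, not_lt.1 hcon]
    have h3 : k = 0 := by
      have : |k| < 1 := by exact_mod_cast h2
      exact Int.abs_lt_one_iff.1 this
    apply hτ
    rw [hk', h3]
    simp

/-- The secant angle: a continuous argument of the secant map that extends the tangent angle. -/
theorem exists_secantAngle (h : IsSimpleLoop c θ L) :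
    ∃ ψ : ℝ × ℝ → ℝ, IsArgOn (secant θ) ψ (strip L) ∧ ∀ s, ψ (s, 0) = θ s := by
  obtain ⟨ψ, hψ⟩ := exists_isArgOn (convex_strip L) (isOpen_strip L)
    ⟨(0, 0), by simpa [strip] using h.pos⟩ h.continuous_secant.continuousOn
    (fun p hp => h.secant_ne_zero hp)
  have hm : ∀ s : ℝ, (s, (0 : ℝ)) ∈ strip L := fun s => by simpa [strip] using h.pos
  have h1 : IsArgOn (fun s : ℝ => secant θ (s, 0)) (fun s => ψ (s, 0)) Set.univ :=
    ⟨hψ.1.comp (by fun_prop) (fun s _ => hm s), fun s _ => hψ.2 _ (hm s)⟩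
  have h2 : IsArgOn (fun s : ℝ => secant θ (s, 0)) θ Set.univ :=
    ⟨h.continuous_angle.continuousOn, fun s _ => by simp [secant_zero]⟩
  obtain ⟨k, hk⟩ := IsArgOn.sub_const isPreconnected_univ h1 h2 (β := 0) (fun _ => 1)
    (fun s _ => h.secant_ne_zero (hm s)) (fun _ _ => one_pos) (fun s _ => by simp)
  refine ⟨fun p => ψ p - 2 * Real.pi * k, ⟨hψ.1.sub continuousOn_const, fun p hp => ?_⟩, fun s => ?_⟩
  · rw [exp_I_mul_eq_iff.2 ⟨-k, (by push_cast; ring : _ = ψ p + _)⟩]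
    exact hψ.2 p hp
  · have := hk s trivial
    simp only at this ⊢
    linarith

/-- The chord from `c(s)` to `c(s + τ)` is opposite to the chord from `c(s + τ)` to
`c(s + L) = c(s)`; using this twice gives that the angles of the two differ by half the total
turning of the tangent, which therefore is an odd multiple of `π`. -/
theorem secantAngle_swap (h : IsSimpleLoop c θ L) {ψ : ℝ × ℝ → ℝ}
    (hψ : IsArgOn (secant θ) ψ (strip L)) (hψ0 : ∀ s, ψ (s, 0) = θ s) {k : ℤ}
    (hk : ∀ s, θ (s + L) = θ s + 2 * Real.pi * k) :
    Odd k ∧ ∀ s τ, 0 < τ → τ < L → ψ (s + τ, L - τ) = ψ (s, τ) + Real.pi * k := by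
  set V : Set (ℝ × ℝ) := {p | 0 < p.2 ∧ p.2 < L} with hV
  have hVs : V ⊆ strip L := fun p hp => abs_lt.2 ⟨by linarith [hp.1, h.pos], hp.2⟩
  have hVc : Convex ℝ V := by
    have : V = (LinearMap.snd ℝ ℝ ℝ) ⁻¹' (Set.Ioo 0 L) := by ext p; simp [hV]
    rw [this]
    exact (convex_Ioo _ _).linear_preimage _
  have hm : Set.MapsTo (fun p : ℝ × ℝ => (p.1 + p.2, L - p.2)) V (strip L) := fun p hp =>
    hVs ⟨by simpa using hp.2, by simpa using hp.1⟩
  have h1 : IsArgOn (fun p : ℝ × ℝ => secant θ (p.1 + p.2, L - p.2))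
      (fun p => ψ (p.1 + p.2, L - p.2)) V :=
    ⟨hψ.1.comp (by fun_prop) hm, fun p hp => hψ.2 _ (hm hp)⟩
  obtain ⟨m, hm'⟩ := IsArgOn.sub_const hVc.isPreconnected (hψ.mono hVs) h1 (β := Real.pi)
    (fun p => (L - p.2) / p.2) (fun p hp => h.secant_ne_zero (hVs hp))
    (fun p hp => div_pos (sub_pos.2 hp.2) hp.1) (fun p hp => by
      have e1 := h.mul_secant p.1 p.2
      have e2 := h.mul_secant (p.1 + p.2) (L - p.2)
      rw [show p.1 + p.2 + (L - p.2) = p.1 + L by ring, h.periodic] at e2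
      have hp0 : (p.2 : ℂ) ≠ 0 := by exact_mod_cast hp.1.ne'
      have e3 : Complex.exp (Complex.I * (Real.pi : ℂ)) = -1 := by
        rw [mul_comm]; exact Complex.exp_pi_mul_I
      rw [e3]
      apply mul_left_cancel₀ hp0
      push_cast at e2 ⊢
      rw [e1]
      field_simp
      linear_combination e2)
  have hsw : ∀ s τ, 0 < τ → τ < L →
      ψ (s, τ) = ψ (s + τ, L - τ) + Real.pi + 2 * Real.pi * m :=
    fun s τ h0 hτ => hm' (s, τ) ⟨h0, hτ⟩
  have hpi := Real.pi_pos
  have hkm : (k : ℝ) = -(1 + 2 * m) := by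
    have hL := h.pos
    have e1 := hsw 0 (L / 2) (by linarith) (by linarith)
    have e2 := hsw (0 + L / 2) (L - L / 2) (by linarith) (by linarith)
    rw [show (0 : ℝ) + L / 2 + (L - L / 2) = 0 + L by ring,
      show L - (L - L / 2) = L / 2 by ring,
      hψ.secant_shift h.pos (fun p hp => h.secant_ne_zero hp) hψ0 hk
        (hVs ⟨by simp; linarith, by simp; linarith⟩)] at e2
    have : Real.pi * (k : ℝ) = Real.pi * (-(1 + 2 * m)) := by linarith
    exact mul_left_cancel₀ hpi.ne' this
  refine ⟨⟨-m - 1, ?_⟩, fun s τ h0 hτ => ?_⟩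
  · have : (k : ℝ) = ((2 * (-m - 1) + 1 : ℤ) : ℝ) := by rw [hkm]; push_cast; ring
    exact_mod_cast this
  · have := hsw s τ h0 hτ
    rw [hkm]
    linarith

/-- **Hopf's Umlaufsatz**: the tangent of a simple closed curve turns by `2πσ`, with `σ = 1` if the
curve lies to the left of one of its tangents, and `σ = -1` if it lies to the right. -/
theorem rotation_eq (h : IsSimpleLoop c θ L) {k : ℤ}
    (hk : ∀ s, θ (s + L) = θ s + 2 * Real.pi * k) {σ : ℤ} (hσ : σ = 1 ∨ σ = -1)
    (hside : ∀ t, 0 ≤ (σ : ℝ) * (Complex.exp (Complex.I * ((-θ 0 : ℝ) : ℂ)) * (c t - c 0)).im) :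
    k = σ := by
  obtain ⟨ψ, hψ, hψ0⟩ := h.exists_secantAngle
  obtain ⟨hodd, hsw⟩ := h.secantAngle_swap hψ hψ0 hk
  have hL := h.pos
  have hmem : ∀ s τ : ℝ, 0 ≤ τ → τ < L → (s, τ) ∈ strip L := fun s τ h1 h2 =>
    abs_lt.2 ⟨by simpa using by linarith, h2⟩
  -- the angle from the tangent at `0` to the secants through `c(0)`, extended to `τ = L`
  set X : ℝ → ℝ := fun τ => if τ < L then ψ (0, τ) - θ 0 else Real.pi * k with hX
  have hX1 : ∀ τ, τ < L → X τ = ψ (0, τ) - θ 0 := fun τ hτ => if_pos hτ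
  have hX2 : X L = Real.pi * k := if_neg (lt_irrefl L)
  have hXc : ContinuousOn X (Set.Icc 0 L) := by
    intro τ hτ
    rcases lt_or_eq_of_le hτ.2 with hlt | rfl
    · have hc : ContinuousAt (fun τ : ℝ => ψ (0, τ) - θ 0) τ := by
        have h1 : ContinuousAt ψ (0, τ) :=
          hψ.1.continuousAt ((isOpen_strip L).mem_nhds (hmem 0 τ hτ.1 hlt))
        have h2 : ContinuousAt (fun τ : ℝ => ((0 : ℝ), τ)) τ := by fun_prop
        exact (ContinuousAt.comp (f := fun τ : ℝ => ((0 : ℝ), τ)) h1 h2).sub continuousAt_const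
      exact (hc.congr (Filter.eventually_of_mem (Iio_mem_nhds hlt)
        fun x hx => (hX1 x hx).symm)).continuousWithinAt
    · have hc : ContinuousAt (fun x : ℝ => ψ (x, τ - x) - Real.pi * k - θ 0) τ := by
        have h1 : ContinuousAt ψ (τ, τ - τ) :=
          hψ.1.continuousAt ((isOpen_strip τ).mem_nhds (hmem _ _ (by simp) (by simpa using hL)))
        have h2 : ContinuousAt (fun x : ℝ => (x, τ - x)) τ := by fun_prop
        exact ((ContinuousAt.comp (f := fun x : ℝ => (x, τ - x)) h1 h2).sub
          continuousAt_const).sub continuousAt_const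
      refine hc.continuousWithinAt.congr_of_eventuallyEq ?_ ?_
      · filter_upwards [self_mem_nhdsWithin, mem_nhdsWithin_of_mem_nhds (Ioi_mem_nhds hL)]
          with x hx hx0
        rcases lt_or_eq_of_le hx.2 with hlt | rfl
        · have := hsw 0 x hx0 hlt
          rw [zero_add] at this
          rw [hX1 x hlt, this]
          ring
        · have := hk 0
          rw [zero_add] at this
          rw [hX2, sub_self, hψ0, this]
          ring
      · have := hk 0
        rw [zero_add] at this
        rw [hX2, sub_self, hψ0, this]
        ring
  have hσ2 : (σ : ℝ) * σ = 1 := by rcases hσ with rfl | rfl <;> norm_num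
  have hsin : ∀ τ ∈ Set.Icc 0 L, 0 ≤ (σ : ℝ) * Real.sin (X τ) := by
    intro τ hτ
    rcases lt_or_eq_of_le hτ.2 with hlt | rfl
    · rcases lt_or_eq_of_le hτ.1 with h0 | rfl
      · have e1 := h.mul_secant 0 τ
        rw [zero_add, hψ.2 (0, τ) (hmem 0 τ hτ.1 hlt)] at e1
        have hq : 0 < ‖secant θ (0, τ)‖ := norm_pos_iff.2 (h.secant_ne_zero (hmem 0 τ hτ.1 hlt))
        have e2 : Complex.exp (Complex.I * ((-θ 0 : ℝ) : ℂ)) * (c τ - c 0) =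
            ((τ * ‖secant θ (0, τ)‖ : ℝ) : ℂ) * Complex.exp ((X τ : ℝ) * Complex.I) := by
          rw [← e1, hX1 τ hlt]
          have : Complex.exp (((ψ (0, τ) - θ 0 : ℝ) : ℂ) * Complex.I) =
              Complex.exp (Complex.I * ((-θ 0 : ℝ) : ℂ)) *
                Complex.exp (Complex.I * (ψ (0, τ) : ℂ)) := by
            rw [← Complex.exp_add]; congr 1; push_cast; ring
          rw [this]
          push_cast
          ring
        have e3 := hside τ
        rw [e2, Complex.im_ofReal_mul, Complex.exp_ofReal_mul_I_im] at e3
        have e4 : 0 < τ * ‖secant θ (0, τ)‖ := mul_pos h0 hq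
        by_contra hcon
        nlinarith [not_le.1 hcon]
      · rw [hX1 0 hL, hψ0]; simp
    · rw [hX2, mul_comm Real.pi, Real.sin_int_mul_pi, mul_zero]
  have key := eq_one_of_sin_nonneg (Y := fun τ => σ * X τ) hL.le (continuousOn_const.mul hXc)
    (k := σ * k) (fun τ hτ => by
      rcases hσ with rfl | rfl
      · simpa using hsin τ hτ
      · simpa using hsin τ hτ)
    (by rw [hX1 0 hL, hψ0]; ring)
    (by rcases hσ with rfl | rfl
        · simpa using hodd
        · simpa using hodd.neg)
    (by rw [hX2]; push_cast; ring)
  rcases hσ with rfl | rfl <;> omega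

/-- If a simple closed curve is mapped to itself by a nontrivial rotation about the origin that
shifts the parameter by `T`, then the argument of the curve grows over the time `T` as much as its
tangent angle does: the chord from `c(s)` to `c(s + T)` makes a constant angle with `c(s)`, and it
turns as much as the tangent since the secant angle is continuous. -/
theorem arg_add_of_symmetric (h : IsSimpleLoop c θ L) {T α : ℝ} (hT0 : 0 < T) (hTL : T < L)
    (hT : ∀ s, θ (s + T) = θ s + α)
    (hcT : ∀ s, c (s + T) = Complex.exp (Complex.I * (α : ℂ)) * c s) {χ : ℝ → ℝ}
    (hχ : IsArgOn c χ Set.univ) (s : ℝ) : χ (s + T) = χ s + α := by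
  obtain ⟨ψ, hψ, hψ0⟩ := h.exists_secantAngle
  have hmem : ∀ s : ℝ, (s, T) ∈ strip L := fun s => abs_lt.2 ⟨by linarith, hTL⟩
  have h1 : IsArgOn (fun s : ℝ => secant θ (s, T)) (fun s => ψ (s, T)) Set.univ :=
    ⟨hψ.1.comp (by fun_prop) (fun s _ => hmem s), fun s _ => hψ.2 _ (hmem s)⟩
  set b : ℂ := (Complex.exp (Complex.I * (α : ℂ)) - 1) / T with hb
  have hT0' : (T : ℂ) ≠ 0 := by exact_mod_cast hT0.ne'
  have hq : ∀ s, secant θ (s, T) = b * c s := by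
    intro s
    have := h.mul_secant s T
    rw [hcT] at this
    apply mul_left_cancel₀ hT0'
    rw [this, hb]
    field_simp
  have hb0 : b ≠ 0 := by
    intro h0
    exact h.secant_ne_zero (hmem 0) (by rw [hq, h0, zero_mul])
  obtain ⟨k, hk⟩ := IsArgOn.sub_const isPreconnected_univ h1 hχ (β := b.arg) (fun _ => ‖b‖)
    (fun s _ => h.secant_ne_zero (hmem s)) (fun _ _ => norm_pos_iff.2 hb0)
    (fun s _ => by rw [hq, mul_comm Complex.I, Complex.norm_mul_exp_arg_mul_I])
  have e1 := hψ.secant_shift h.pos (fun p hp => h.secant_ne_zero hp) hψ0 hT (hmem s)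
  have e2 := hk s trivial
  have e3 := hk (s + T) trivial
  linarith

/-- A nontrivial rotational symmetry keeps a simple closed curve off the origin. -/
theorem ne_zero_of_symmetric (h : IsSimpleLoop c θ L) {T α : ℝ} (hT0 : 0 < T) (hTL : T < L)
    (hcT : ∀ s, c (s + T) = Complex.exp (Complex.I * (α : ℂ)) * c s) (s : ℝ) : c s ≠ 0 := by
  intro h0
  have h1 := h.mul_secant s T
  rw [hcT, h0, mul_zero, sub_zero] at h1
  have h2 := h.secant_ne_zero (p := (s, T)) (abs_lt.2 ⟨by linarith, hTL⟩)
  have h3 : (T : ℂ) ≠ 0 := by exact_mod_cast hT0.ne'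
  exact mul_ne_zero h3 h2 h1

end IsSimpleLoop

/-! ### Flow lines through moving coordinates, and their uniqueness -/

/-- A solution of `κ = f(r)` that is defined for all times, with its unit tangent `u` and its
curvature `κ`. The curvature is continuously differentiable also where the curve meets the
origin. -/
structure IsGlobalSolution (f : ℝ → ℝ) (c u : ℝ → ℂ) (κ : ℝ → ℝ) : Prop where
  hasDerivAt : ∀ t, HasDerivAt c (u t) t
  hasDerivAt_tangent : ∀ t, HasDerivAt u (Complex.I * (κ t : ℂ) * u t) t
  norm_tangent : ∀ t, ‖u t‖ = 1
  contDiff_curvature : ContDiff ℝ 1 κ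
  curvature_eq : ∀ t, c t ≠ 0 → κ t = f ‖c t‖

/-- The position of the origin relative to the moving point, in the frame of the moving tangent,
up to a reflection: `t ↦ -i conj(c(t)) u(t)`. -/
noncomputable def movingPath (c u : ℝ → ℂ) (t : ℝ) : ℂ :=
  -Complex.I * (starRingEnd ℂ) (c t) * u t

theorem field_zero (f : ℝ → ℝ) : field f 0 = -Complex.I := by simp [field]

theorem exists_lipschitzOnWith_field {f : ℝ → ℝ} (hf : ContDiffOn ℝ ∞ f (Set.Ioi 0)) {z : ℂ}
    (hz : z ≠ 0) : ∃ K, ∃ s ∈ nhds z, LipschitzOnWith K (field f) s := by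
  have h1 : ContDiffAt ℝ 1 (fun z : ℂ => f ‖z‖) z :=
    ((hf.contDiffAt (Ioi_mem_nhds (norm_pos_iff.2 hz))).of_le (by simp)).comp z
      (contDiffAt_norm ℝ hz)
  have h2 : ContDiffAt ℝ 1 (fun z : ℂ => (f ‖z‖ : ℂ)) z :=
    Complex.ofRealCLM.contDiff.contDiffAt.comp z h1
  have h3 : ContDiffAt ℝ 1 (field f) z :=
    ((contDiffAt_const.mul contDiffAt_id).mul h2).sub contDiffAt_const
  exact h3.exists_lipschitzOnWith

namespace IsGlobalSolution

variable {f : ℝ → ℝ} {c u : ℝ → ℂ} {κ : ℝ → ℝ}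

theorem shift (h : IsGlobalSolution f c u κ) (a : ℝ) :
    IsGlobalSolution f (fun t => c (t + a)) (fun t => u (t + a)) (fun t => κ (t + a)) where
  hasDerivAt t := (h.hasDerivAt (t + a)).comp_add_const t a
  hasDerivAt_tangent t := (h.hasDerivAt_tangent (t + a)).comp_add_const t a
  norm_tangent _ := h.norm_tangent _
  contDiff_curvature := h.contDiff_curvature.comp (contDiff_id.add contDiff_const)
  curvature_eq _ ht := h.curvature_eq _ ht

theorem continuous (h : IsGlobalSolution f c u κ) : Continuous c :=
  continuous_iff_continuousAt.2 fun t => (h.hasDerivAt t).continuousAt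

theorem continuous_tangent (h : IsGlobalSolution f c u κ) : Continuous u :=
  continuous_iff_continuousAt.2 fun t => (h.hasDerivAt_tangent t).continuousAt

theorem tangent_mul_conj (h : IsGlobalSolution f c u κ) (t : ℝ) :
    u t * (starRingEnd ℂ) (u t) = 1 := by
  rw [Complex.mul_conj, Complex.normSq_eq_norm_sq, h.norm_tangent]; simp

theorem hasDerivAt_movingPath (h : IsGlobalSolution f c u κ) (t : ℝ) :
    HasDerivAt (movingPath c u) (Complex.I * (κ t : ℂ) * movingPath c u t - Complex.I) t := by
  have h1 : HasDerivAt (fun t => (starRingEnd ℂ) (c t)) ((starRingEnd ℂ) (u t)) t :=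
    (h.hasDerivAt t).star
  have h2 := (h1.const_mul (-Complex.I)).mul (h.hasDerivAt_tangent t)
  refine h2.congr_deriv ?_
  simp only [movingPath]
  linear_combination (-Complex.I) * h.tangent_mul_conj t

theorem continuous_movingPath (h : IsGlobalSolution f c u κ) : Continuous (movingPath c u) :=
  continuous_iff_continuousAt.2 fun t => (h.hasDerivAt_movingPath t).continuousAt

theorem norm_movingPath (h : IsGlobalSolution f c u κ) (t : ℝ) : ‖movingPath c u t‖ = ‖c t‖ := by
  simp [movingPath, h.norm_tangent]

theorem movingPath_eq_zero_iff (h : IsGlobalSolution f c u κ) (t : ℝ) :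
    movingPath c u t = 0 ↔ c t = 0 := by
  rw [← norm_eq_zero, h.norm_movingPath, norm_eq_zero]

theorem hasDerivAt_movingPath_field (h : IsGlobalSolution f c u κ) (t : ℝ) :
    HasDerivAt (movingPath c u) (field f (movingPath c u t)) t := by
  refine (h.hasDerivAt_movingPath t).congr_deriv ?_
  by_cases h0 : c t = 0
  · rw [(h.movingPath_eq_zero_iff t).2 h0, field_zero]; simp
  · rw [field, h.norm_movingPath, ← h.curvature_eq t h0]; ring

theorem isFlowLine_movingPath (h : IsGlobalSolution f c u κ) : IsFlowLine f (movingPath c u) where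
  continuous := h.continuous_movingPath
  hasDerivAt t _ := h.hasDerivAt_movingPath_field t
  dense := by
    rw [dense_iff_closure_eq]
    refine Set.eq_univ_of_forall fun t => ?_
    by_cases h0 : movingPath c u t = 0
    · have h1 := (h.hasDerivAt_movingPath_field t)
      rw [h0, field_zero] at h1
      have h2 : ∀ᶠ s in nhdsWithin t {t}ᶜ, movingPath c u s ≠ 0 :=
        h1.eventually_ne (by simp)
      rw [mem_closure_iff_frequently]
      exact (h2.frequently).filter_mono nhdsWithin_le_nhds
    · exact subset_closure h0

/-- Where the curve meets the origin, its distance to the origin grows with speed at least `1/2`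
for some time. -/
theorem exists_norm_sub_ge (h : IsGlobalSolution f c u κ) {t₀ : ℝ} (h0 : c t₀ = 0) :
    ∃ ε > 0, ∀ s₁ s₂, 0 ≤ s₁ → s₁ ≤ s₂ → s₂ < ε →
      (s₂ - s₁) / 2 ≤ ‖c (t₀ + s₂)‖ - ‖c (t₀ + s₁)‖ := by
  have hs : HasStrictDerivAt c (u t₀) t₀ :=
    hasStrictDerivAt_of_hasDerivAt_of_continuousAt (Filter.Eventually.of_forall h.hasDerivAt)
      h.continuous_tangent.continuousAt
  have h1 := hs.isLittleO.def (show (0 : ℝ) < 1 / 8 by norm_num)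
  obtain ⟨ε, hε, hb⟩ := Metric.eventually_nhds_iff.1 h1
  have hE : ∀ s₁ s₂, 0 ≤ s₁ → s₁ < ε → 0 ≤ s₂ → s₂ < ε →
      ‖c (t₀ + s₂) - c (t₀ + s₁) - ((s₂ - s₁ : ℝ) : ℂ) * u t₀‖ ≤ 1 / 8 * |s₂ - s₁| := by
    intro s₁ s₂ h1 h2 h3 h4
    have := hb (y := (t₀ + s₂, t₀ + s₁)) (by
      rw [Prod.dist_eq]
      simpa [abs_of_nonneg h1, abs_of_nonneg h3] using ⟨h4, h2⟩)
    simpa [Real.norm_eq_abs] using this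
  refine ⟨ε, hε, fun s₁ s₂ hs1 hs12 hs2 => ?_⟩
  have hd : 0 ≤ s₂ - s₁ := sub_nonneg.2 hs12
  have e := hE s₁ s₂ hs1 (hs12.trans_lt hs2) (hs1.trans hs12) hs2
  rw [abs_of_nonneg hd] at e
  rcases eq_or_lt_of_le hs1 with rfl | hpos
  · rw [sub_zero] at e hd
    rw [add_zero, h0, norm_zero, sub_zero] at *
    have e1 := norm_sub_norm_le (((s₂ : ℝ) : ℂ) * u t₀) (((s₂ : ℝ) : ℂ) * u t₀ - c (t₀ + s₂))
    rw [sub_sub_cancel, norm_mul, h.norm_tangent, mul_one, Complex.norm_real, Real.norm_eq_abs,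
      abs_of_nonneg hd, norm_sub_rev] at e1
    linarith
  · have e1 := hE 0 s₁ le_rfl hε hs1 (hs12.trans_lt hs2)
    rw [add_zero, h0, sub_zero, sub_zero, abs_of_pos hpos] at e1
    set a := c (t₀ + s₁) with ha
    set b := c (t₀ + s₂) with hb'
    set d := s₂ - s₁ with hd'
    set r := a - (s₁ : ℂ) * u t₀ with hr
    have hs0 : (s₁ : ℂ) ≠ 0 := by exact_mod_cast hpos.ne'
    -- `b` is close to `a + d u(t₀)`, and `u(t₀)` is close to `a / s₁`
    have e2 : ((1 + d / s₁ : ℝ) : ℂ) * a =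
        b - (b - a - (d : ℂ) * u t₀) + ((d / s₁ : ℝ) : ℂ) * r := by
      rw [hr]
      push_cast
      field_simp
      ring
    have e3 : (1 + d / s₁) * ‖a‖ ≤ ‖b‖ + 1 / 8 * d + d / s₁ * (1 / 8 * s₁) := by
      have hq : 0 ≤ d / s₁ := by positivity
      have := congrArg norm e2
      rw [norm_mul, Complex.norm_real, Real.norm_eq_abs, abs_of_nonneg (by positivity)] at this
      rw [this]
      refine (norm_add_le _ _).trans (add_le_add ((norm_sub_le _ _).trans
        (add_le_add le_rfl e)) ?_)
      rw [norm_mul, Complex.norm_real, Real.norm_eq_abs, abs_of_nonneg hq]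
      exact mul_le_mul_of_nonneg_left e1 hq
    have e4 : 7 / 8 * s₁ ≤ ‖a‖ := by
      have := norm_sub_norm_le ((s₁ : ℂ) * u t₀) ((s₁ : ℂ) * u t₀ - a)
      rw [sub_sub_cancel, norm_mul, h.norm_tangent, mul_one, Complex.norm_real, Real.norm_eq_abs,
        abs_of_pos hpos, norm_sub_rev] at this
      linarith
    have e5 : d / s₁ * (7 / 8 * s₁) ≤ d / s₁ * ‖a‖ :=
      mul_le_mul_of_nonneg_left e4 (by positivity)
    have e6 : d / s₁ * s₁ = d := by field_simp
    nlinarith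

/-- If the curve meets the origin, then its curvature is a smooth function of time there; hence
`f` is Lipschitz and bounded near `0`, and the vector field is Lipschitz near `0`. -/
theorem exists_lipschitzOnWith_field_zero (h : IsGlobalSolution f c u κ) {t₀ : ℝ}
    (h0 : c t₀ = 0) : ∃ K, ∃ s ∈ nhds (0 : ℂ), LipschitzOnWith K (field f) s := by
  obtain ⟨ε, hε, hgrow⟩ := h.exists_norm_sub_ge h0
  obtain ⟨K, U, hU, hK⟩ := (h.contDiff_curvature.contDiffAt (x := t₀)).exists_lipschitzOnWith
  obtain ⟨ε', hε', hball⟩ := Metric.mem_nhds_iff.1 hU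
  set a := min ε ε' / 2 with ha
  have ha0 : 0 < a := by positivity
  have haε : a < ε := by have := min_le_left ε ε'; have := lt_min hε hε'; linarith
  have haε' : a < ε' := by have := min_le_right ε ε'; have := lt_min hε hε'; linarith
  have hmem : ∀ s, 0 ≤ s → s ≤ a → t₀ + s ∈ U := fun s hs hsa => hball (by
    simpa [abs_of_nonneg hs] using hsa.trans_lt haε')
  have hinv : ∀ r, 0 < r → r < ‖c (t₀ + a)‖ →
      ∃ s, 0 ≤ s ∧ s ≤ a ∧ ‖c (t₀ + s)‖ = r ∧ f r = κ (t₀ + s) := by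
    intro r hr hra
    have hc := h.continuous
    obtain ⟨s, hs, hsr⟩ := intermediate_value_Icc ha0.le
      (f := fun s => ‖c (t₀ + s)‖) (by fun_prop)
      (show r ∈ Set.Icc _ _ from ⟨by simpa [h0] using hr.le, hra.le⟩)
    refine ⟨s, hs.1, hs.2, hsr, ?_⟩
    simp only at hsr
    rw [h.curvature_eq _ (norm_pos_iff.1 (hsr ▸ hr)), hsr]
  have hδ : 0 < ‖c (t₀ + a)‖ := by
    have := hgrow 0 a le_rfl ha0.le haε
    rw [add_zero, h0, norm_zero] at this
    linarith
  set δ := ‖c (t₀ + a)‖ with hδ'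
  have hlip : ∀ r s, 0 < r → r < δ → 0 < s → s < δ → |f r - f s| ≤ K * (2 * |r - s|) := by
    intro r s hr hrδ hs hsδ
    obtain ⟨x, hx0, hxa, hxr, hfx⟩ := hinv r hr hrδ
    obtain ⟨y, hy0, hya, hys, hfy⟩ := hinv s hs hsδ
    have e1 := hK.dist_le_mul _ (hmem x hx0 hxa) _ (hmem y hy0 hya)
    rw [Real.dist_eq, Real.dist_eq, add_sub_add_left_eq_sub, ← hfx, ← hfy] at e1
    refine e1.trans (mul_le_mul_of_nonneg_left ?_ K.2)
    rcases le_total x y with hxy | hxy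
    · have := hgrow x y hx0 hxy (hya.trans_lt haε)
      rw [hxr, hys] at this
      rw [abs_sub_comm x y, abs_sub_comm r s, abs_of_nonneg (sub_nonneg.2 hxy)]
      have := le_abs_self (s - r)
      linarith
    · have := hgrow y x hy0 hxy (hxa.trans_lt haε)
      rw [hxr, hys] at this
      rw [abs_of_nonneg (sub_nonneg.2 hxy)]
      have := le_abs_self (r - s)
      linarith
  have hbd : ∀ r, 0 < r → r < δ → |f r| ≤ |κ t₀| + K * a := by
    intro r hr hrδ
    obtain ⟨x, hx0, hxa, hxr, hfx⟩ := hinv r hr hrδ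
    have e1 := hK.dist_le_mul _ (hmem x hx0 hxa) _ (hmem 0 le_rfl ha0.le)
    rw [Real.dist_eq, Real.dist_eq, add_sub_add_left_eq_sub, ← hfx, add_zero, sub_zero,
      abs_of_nonneg hx0] at e1
    have e2 := abs_add_le (f r - κ t₀) (κ t₀)
    rw [sub_add_cancel] at e2
    have e3 : (K : ℝ) * x ≤ K * a := mul_le_mul_of_nonneg_left hxa K.2
    linarith
  have hC : 0 ≤ |κ t₀| + K * a + δ * (K * 2) := by positivity
  refine ⟨(|κ t₀| + K * a + δ * (K * 2)).toNNReal, Metric.ball 0 δ, Metric.ball_mem_nhds _ hδ,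
    LipschitzOnWith.of_dist_le_mul fun z hz w hw => ?_⟩
  rw [mem_ball_zero_iff] at hz hw
  have e0 : dist (field f z) (field f w) = ‖z * (f ‖z‖ : ℂ) - w * (f ‖w‖ : ℂ)‖ := by
    rw [dist_eq_norm, field, field, show Complex.I * z * (f ‖z‖ : ℂ) - Complex.I -
      (Complex.I * w * (f ‖w‖ : ℂ) - Complex.I) =
      Complex.I * (z * (f ‖z‖ : ℂ) - w * (f ‖w‖ : ℂ)) by ring, norm_mul, Complex.norm_I, one_mul]
  rw [e0, Real.coe_toNNReal _ hC, dist_eq_norm]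
  have hB : 0 ≤ |κ t₀| + K * a := by positivity
  have hBle : |κ t₀| + K * a ≤ |κ t₀| + K * a + δ * (K * 2) :=
    le_add_of_nonneg_right (by positivity)
  by_cases hz0 : z = 0
  · rw [hz0, zero_mul, zero_sub, zero_sub, norm_neg, norm_neg, norm_mul, Complex.norm_real,
      Real.norm_eq_abs, mul_comm]
    by_cases hw0 : w = 0
    · simp [hw0]
    · exact mul_le_mul_of_nonneg_right ((hbd _ (norm_pos_iff.2 hw0) hw).trans hBle) (norm_nonneg _)
  by_cases hw0 : w = 0
  · rw [hw0, zero_mul, sub_zero, sub_zero, norm_mul, Complex.norm_real, Real.norm_eq_abs, mul_comm]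
    exact mul_le_mul_of_nonneg_right ((hbd _ (norm_pos_iff.2 hz0) hz).trans hBle) (norm_nonneg _)
  have e1 : z * (f ‖z‖ : ℂ) - w * (f ‖w‖ : ℂ) =
      (z - w) * (f ‖w‖ : ℂ) + z * ((f ‖z‖ - f ‖w‖ : ℝ) : ℂ) := by push_cast; ring
  rw [e1]
  refine (norm_add_le _ _).trans ?_
  rw [norm_mul, norm_mul, Complex.norm_real, Complex.norm_real, Real.norm_eq_abs,
    Real.norm_eq_abs, add_mul]
  refine add_le_add ?_ ?_
  · rw [mul_comm]
    exact mul_le_mul_of_nonneg_right (hbd _ (norm_pos_iff.2 hw0) hw) (norm_nonneg _)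
  · rw [mul_assoc, mul_assoc]
    refine mul_le_mul hz.le ((hlip _ _ (norm_pos_iff.2 hz0) hz (norm_pos_iff.2 hw0) hw).trans ?_)
      (abs_nonneg _) hδ.le
    exact mul_le_mul_of_nonneg_left
      (mul_le_mul_of_nonneg_left (abs_norm_sub_norm_le z w) zero_le_two) K.2

end IsGlobalSolution

/-- Near the origin a flow line moves downwards where it is off the origin; so it can not return
to the origin at once. -/
theorem IsFlowLine.not_two_zeros {f : ℝ → ℝ} {η : ℝ → ℂ} (hη : IsFlowLine f η) {a b : ℝ}
    (hab : a < b) (him : ∀ t ∈ Set.Icc a b, (field f (η t)).im < 0) (ha : η a = 0)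
    (hb : η b = 0) : False := by
  have hder : ∀ t, η t ≠ 0 → HasDerivAt (fun t => (η t).im) (field f (η t)).im t := fun t ht =>
    (Complex.imCLM.hasFDerivAt.comp_hasDerivAt t (hη.hasDerivAt t ht))
  obtain ⟨m, hm, hm0⟩ := hη.dense.exists_mem_open (isOpen_Ioo (a := a) (b := b))
    (Set.nonempty_Ioo.2 hab)
  have hne : ∃ m ∈ Set.Ioo a b, (η m).im ≠ 0 := by
    have h1 : ∀ᶠ s in nhdsWithin m {m}ᶜ, (η s).im ≠ 0 :=
      (hder m hm).eventually_ne (him m (Set.Ioo_subset_Icc_self hm0)).ne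
    have h2 : ∀ᶠ s in nhdsWithin m {m}ᶜ, s ∈ Set.Ioo a b :=
      nhdsWithin_le_nhds (isOpen_Ioo.mem_nhds hm0)
    obtain ⟨s, hs1, hs2⟩ := (h1.and h2).exists
    exact ⟨s, hs2, hs1⟩
  have hcont : ContinuousOn (fun t => (η t).im) (Set.Icc a b) :=
    (Complex.continuous_im.comp hη.continuous).continuousOn
  have hne' : (Set.Icc a b).Nonempty := Set.nonempty_Icc.2 hab.le
  -- a nonzero extreme value is assumed where the derivative exists and does not vanish
  have key : ∀ x ∈ Set.Icc a b, (η x).im ≠ 0 →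
      ¬ IsExtrOn (fun t => (η t).im) (Set.Icc a b) x := by
    intro x hx hx0 hext
    have hxI : x ∈ Set.Ioo a b := by
      refine ⟨lt_of_le_of_ne hx.1 ?_, lt_of_le_of_ne hx.2 ?_⟩
      · rintro rfl; exact hx0 (by rw [ha]; rfl)
      · rintro rfl; exact hx0 (by rw [hb]; rfl)
    have hl := hext.isLocalExtr (Icc_mem_nhds hxI.1 hxI.2)
    exact (him x hx).ne (hl.hasDerivAt_eq_zero (hder x fun h0 => hx0 (by rw [h0]; rfl)))
  obtain ⟨m, hm, hm0⟩ := hne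
  have hmI := Set.Ioo_subset_Icc_self hm
  rcases lt_or_gt_of_ne hm0 with hneg | hpos
  · obtain ⟨x, hx, hmin⟩ := isCompact_Icc.exists_isMinOn hne' hcont
    exact key x hx ((hmin hmI).trans_lt hneg).ne hmin.isExtr
  · obtain ⟨x, hx, hmax⟩ := isCompact_Icc.exists_isMaxOn hne' hcont
    exact key x hx (hpos.trans_le (hmax hmI)).ne' hmax.isExtr

/-- Where the vector field is continuous at the origin, with the value `-i` there, a flow line that
meets the origin solves the ODE also at that time. -/
theorem IsFlowLine.eventually_hasDerivAt {f : ℝ → ℝ} {η : ℝ → ℂ} (hη : IsFlowLine f η) {t₀ : ℝ}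
    (h0 : η t₀ = 0) (hf : ContinuousAt (field f) 0) :
    ∀ᶠ t in nhds t₀, HasDerivAt η (field f (η t)) t := by
  have hcomp : ContinuousAt (fun t => field f (η t)) t₀ := by
    have : ContinuousAt (field f) (η t₀) := by rwa [h0]
    exact ContinuousAt.comp this hη.continuous.continuousAt
  have him : ∀ᶠ t in nhds t₀, (field f (η t)).im < 0 := by
    have h1 : ContinuousAt (fun t => (field f (η t)).im) t₀ :=
      Complex.continuous_im.continuousAt.comp hcomp
    refine h1.eventually_lt continuousAt_const ?_
    simp [h0, field_zero]
  obtain ⟨ε, hε, hball⟩ := Metric.eventually_nhds_iff_ball.1 him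
  rw [Real.ball_eq_Ioo] at hball
  have hoff : ∀ t ∈ Set.Ioo (t₀ - ε) (t₀ + ε), t ≠ t₀ → η t ≠ 0 := by
    intro t ht hne ht0
    rcases lt_or_gt_of_ne hne with hlt | hgt
    · exact hη.not_two_zeros hlt (fun s hs => hball s ⟨by linarith [ht.1, hs.1], by linarith [hs.2]⟩)
        ht0 h0
    · exact hη.not_two_zeros hgt (fun s hs => hball s ⟨by linarith [hs.1], by linarith [ht.2, hs.2]⟩)
        h0 ht0
  have hat : HasDerivAt η (field f (η t₀)) t₀ := by
    have hR : HasDerivWithinAt η (field f (η t₀)) (Set.Ici t₀) t₀ := by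
      have hmem : ∀ t ∈ Set.Ioo t₀ (t₀ + ε), η t ≠ 0 := fun t ht =>
        hoff t ⟨by linarith [ht.1], ht.2⟩ ht.1.ne'
      refine hasDerivWithinAt_Ici_of_tendsto_deriv (s := Set.Ioo t₀ (t₀ + ε))
        (fun t ht => (hη.hasDerivAt t (hmem t ht)).differentiableAt.differentiableWithinAt)
        hη.continuous.continuousWithinAt (Ioo_mem_nhdsGT (by linarith)) ?_
      refine (hcomp.tendsto.mono_left nhdsWithin_le_nhds).congr' ?_
      filter_upwards [Ioo_mem_nhdsGT (show t₀ < t₀ + ε by linarith)] with t ht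
      exact (hη.hasDerivAt t (hmem t ht)).deriv.symm
    have hL : HasDerivWithinAt η (field f (η t₀)) (Set.Iic t₀) t₀ := by
      have hmem : ∀ t ∈ Set.Ioo (t₀ - ε) t₀, η t ≠ 0 := fun t ht =>
        hoff t ⟨ht.1, by linarith [ht.2]⟩ ht.2.ne
      refine hasDerivWithinAt_Iic_of_tendsto_deriv (s := Set.Ioo (t₀ - ε) t₀)
        (fun t ht => (hη.hasDerivAt t (hmem t ht)).differentiableAt.differentiableWithinAt)
        hη.continuous.continuousWithinAt (Ioo_mem_nhdsLT (by linarith)) ?_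
      refine (hcomp.tendsto.mono_left nhdsWithin_le_nhds).congr' ?_
      filter_upwards [Ioo_mem_nhdsLT (show t₀ - ε < t₀ by linarith)] with t ht
      exact (hη.hasDerivAt t (hmem t ht)).deriv.symm
    simpa using hL.union hR
  filter_upwards [isOpen_Ioo.mem_nhds
    (show t₀ ∈ Set.Ioo (t₀ - ε) (t₀ + ε) from ⟨by linarith, by linarith⟩)] with t ht
  by_cases hne : t = t₀
  · rw [hne]; exact hat
  · exact hη.hasDerivAt t (hoff t ht hne)

theorem IsFlowLine.shift {f : ℝ → ℝ} {η : ℝ → ℂ} (hη : IsFlowLine f η) (a : ℝ) :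
    IsFlowLine f (fun t => η (t + a)) where
  continuous := hη.continuous.comp (continuous_add_const a)
  hasDerivAt t ht := (hη.hasDerivAt (t + a) ht).comp_add_const t a
  dense := hη.dense.preimage (Homeomorph.addRight a).isOpenMap

namespace IsGlobalSolution

variable {f : ℝ → ℝ} {c u : ℝ → ℂ} {κ : ℝ → ℝ}

/-- The moving path is the only flow line with its initial value. -/
theorem eq_movingPath (hf : ContDiffOn ℝ ∞ f (Set.Ioi 0)) (h : IsGlobalSolution f c u κ)
    {η : ℝ → ℂ} (hη : IsFlowLine f η) (h0 : η 0 = movingPath c u 0) : η = movingPath c u := by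
  have hclosed : IsClosed {t | η t = movingPath c u t} :=
    isClosed_eq hη.continuous h.continuous_movingPath
  have hopen : IsOpen {t | η t = movingPath c u t} := by
    rw [isOpen_iff_mem_nhds]
    intro t ht
    have ht' : η t = movingPath c u t := ht
    have hlip : ∃ K, ∃ s ∈ nhds (η t), LipschitzOnWith K (field f) s := by
      by_cases hz : η t = 0
      · rw [hz]
        exact h.exists_lipschitzOnWith_field_zero
          ((h.movingPath_eq_zero_iff t).1 (by rw [← ht', hz]))
      · exact exists_lipschitzOnWith_field hf hz
    obtain ⟨K, s, hs, hK⟩ := hlip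
    have hder : ∀ᶠ x in nhds t, HasDerivAt η (field f (η x)) x := by
      by_cases hz : η t = 0
      · refine hη.eventually_hasDerivAt hz ?_
        rw [hz] at hs
        exact hK.continuousOn.continuousAt hs
      · filter_upwards [hη.continuous.continuousAt.eventually_ne hz] with x hx
        exact hη.hasDerivAt x hx
    have hηs : ∀ᶠ x in nhds t, η x ∈ s := hη.continuous.continuousAt.eventually_mem hs
    have hζs : ∀ᶠ x in nhds t, movingPath c u x ∈ s :=
      h.continuous_movingPath.continuousAt.eventually_mem (by rwa [← ht'])
    exact ODE_solution_unique_of_eventually (v := fun _ => field f) (s := fun _ => s)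
      (Filter.Eventually.of_forall fun _ => hK) (hder.and hηs)
      ((Filter.Eventually.of_forall h.hasDerivAt_movingPath_field).and hζs) ht'
  have huniv := IsClopen.eq_univ ⟨hclosed, hopen⟩ ⟨0, h0⟩
  funext t
  exact (huniv ▸ Set.mem_univ t : t ∈ {t | η t = movingPath c u t})

theorem flow_movingPath (hf : ContDiffOn ℝ ∞ f (Set.Ioi 0)) (h : IsGlobalSolution f c u κ)
    (t : ℝ) : flow f t (movingPath c u 0) = movingPath c u t := by
  have hex : ∃ ζ : ℝ → ℂ, IsFlowLine f ζ ∧ ζ 0 = movingPath c u 0 :=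
    ⟨_, h.isFlowLine_movingPath, rfl⟩
  rw [flow, dif_pos hex]
  exact congrFun (h.eq_movingPath hf hex.choose_spec.1 hex.choose_spec.2) t

/-- Equal positions at two times continue equally. -/
theorem movingPath_add_eq (hf : ContDiffOn ℝ ∞ f (Set.Ioi 0)) (h : IsGlobalSolution f c u κ)
    {a b : ℝ} (hab : movingPath c u a = movingPath c u b) (t : ℝ) :
    movingPath c u (t + a) = movingPath c u (t + b) :=
  congrFun ((h.shift b).eq_movingPath hf (h.isFlowLine_movingPath.shift a)
    (by simpa [movingPath] using hab)) t

end IsGlobalSolution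

/-! ### Winding numbers of periodic paths -/

/-- The `T`-periodic path `Z` does not meet `w` and winds `k` times around it in one period. -/
def IsWinding (Z : ℝ → ℂ) (T : ℝ) (w : ℂ) (k : ℤ) : Prop :=
  (∀ t, Z t ≠ w) ∧ ∃ χ : ℝ → ℝ, IsArgOn (fun t => Z t - w) χ Set.univ ∧
    ∀ t, χ (t + T) = χ t + 2 * Real.pi * k

theorem int_eq_of_two_pi_mul_eq {k l : ℤ} (h : 2 * Real.pi * (k : ℝ) = 2 * Real.pi * l) : k = l := by
  have := mul_left_cancel₀ Real.two_pi_pos.ne' h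
  exact_mod_cast this

theorem exists_isWinding {Z : ℝ → ℂ} {T : ℝ} (hZ : Continuous Z) (hT : Function.Periodic Z T)
    {w : ℂ} (hw : ∀ t, Z t ≠ w) : ∃ k, IsWinding Z T w k := by
  obtain ⟨χ, hχ⟩ := exists_isArgOn (g := fun t => Z t - w) convex_univ isOpen_univ
    Set.univ_nonempty (by fun_prop) (fun t _ => sub_ne_zero.2 (hw t))
  obtain ⟨k, hk⟩ := hχ.add_period (fun t => by rw [hT t]) (fun t => sub_ne_zero.2 (hw t))
  exact ⟨k, hw, χ, hχ, hk⟩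

/-- The winding number does not change when the point moves continuously off the path. -/
theorem IsWinding.homotopy {Z : ℝ → ℂ} {T : ℝ} (hZ : Continuous Z) (hT : Function.Periodic Z T)
    {w : ℝ → ℂ} (hw : Continuous w) (hZw : ∀ s t, Z t ≠ w s) {a b : ℝ} {k l : ℤ}
    (hk : IsWinding Z T (w a) k) (hl : IsWinding Z T (w b) l) : k = l := by
  obtain ⟨Ψ, hΨ⟩ := exists_isArgOn (g := fun p : ℝ × ℝ => Z p.2 - w p.1) convex_univ isOpen_univ
    Set.univ_nonempty (by fun_prop) (fun p _ => sub_ne_zero.2 (hZw p.1 p.2))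
  have hs : IsArgOn (fun p : ℝ × ℝ => Z p.2 - w p.1) (fun p => Ψ (p.1, p.2 + T)) Set.univ :=
    ⟨hΨ.1.comp (by fun_prop) (fun _ _ => Set.mem_univ _), fun p _ => by
      have := hΨ.2 (p.1, p.2 + T) trivial
      simpa only [hT p.2] using this⟩
  obtain ⟨m, hm⟩ := IsArgOn.sub_const isPreconnected_univ hs hΨ (β := 0) (fun _ => 1)
    (fun p _ => sub_ne_zero.2 (hZw p.1 p.2)) (fun _ _ => one_pos) (fun p _ => by simp)
  have key : ∀ {s : ℝ} {k : ℤ}, IsWinding Z T (w s) k → k = m := by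
    rintro s k ⟨-, χ, hχ, hk⟩
    have h1 : IsArgOn (fun t => Z t - w s) (fun t => Ψ (s, t)) Set.univ :=
      ⟨hΨ.1.comp (by fun_prop) (fun _ _ => Set.mem_univ _), fun t _ => hΨ.2 (s, t) trivial⟩
    obtain ⟨n, hn⟩ := IsArgOn.sub_const isPreconnected_univ hχ h1 (β := 0) (fun _ => 1)
      (fun t _ => sub_ne_zero.2 (hZw s t)) (fun _ _ => one_pos) (fun t _ => by simp)
    have e1 := hk 0
    have e2 := hn 0 trivial
    have e3 := hn (0 + T) trivial
    have e4 := hm (s, 0) trivial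
    simp only at e4
    exact int_eq_of_two_pi_mul_eq (by linarith)
  rw [key hk, key hl]

theorem IsWinding.unique {Z : ℝ → ℂ} {T : ℝ} (hZ : Continuous Z) (hT : Function.Periodic Z T)
    {w : ℂ} {k l : ℤ} (hk : IsWinding Z T w k) (hl : IsWinding Z T w l) : k = l :=
  IsWinding.homotopy hZ hT (w := fun _ => w) continuous_const (fun _ t => hk.1 t) (a := 0) (b := 0)
    hk hl

/-- The winding number over one period may be computed from any starting time. -/
theorem hasWindingNumber_shift_iff {Z : ℝ → ℂ} {T : ℝ} (hZ : Continuous Z) (hT0 : 0 < T)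
    (hT : Function.Periodic Z T) (a : ℝ) (w : ℂ) (k : ℤ) :
    HasWindingNumber (fun t => Z (t + a)) T w k ↔ IsWinding Z T w k := by
  have hconv : ∀ {χ : ℝ → ℝ}, IsArgOn (fun t => Z t - w) χ Set.univ →
      IsArgOn (fun t => Z (t + a) - w) (fun t => χ (t + a)) (Set.Icc 0 T) := fun hχ =>
    ⟨hχ.1.comp (by fun_prop) (fun _ _ => Set.mem_univ _), fun t _ => hχ.2 (t + a) trivial⟩
  constructor
  · rintro ⟨-, hne, θ, hθc, hθ, hθk⟩
    have hw : ∀ t, Z t ≠ w := by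
      intro t
      obtain ⟨s, hs, hst⟩ := (hT.add_const a).exists_mem_Ico₀ hT0 (t - a)
      rw [sub_add_cancel] at hst
      rw [hst]
      exact hne s (Set.Ico_subset_Icc_self hs)
    obtain ⟨l, hl⟩ := exists_isWinding hZ hT hw
    have hl' := hl
    obtain ⟨-, χ, hχ, hχl⟩ := hl'
    have h1 : IsArgOn (fun t => Z (t + a) - w) θ (Set.Icc 0 T) := ⟨hθc, hθ⟩
    obtain ⟨m, hm⟩ := IsArgOn.sub_const (convex_Icc 0 T).isPreconnected h1 (hconv hχ) (β := 0)
      (fun _ => 1) (fun t ht => sub_ne_zero.2 (hne t ht)) (fun _ _ => one_pos) (fun t _ => by simp)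
    have e1 := hm 0 ⟨le_rfl, hT0.le⟩
    have e2 := hm T ⟨hT0.le, le_rfl⟩
    have e3 := hχl a
    rw [add_comm a T] at e3
    rw [zero_add] at e1
    have : k = l := int_eq_of_two_pi_mul_eq (by linarith)
    rw [this]
    exact hl
  · rintro ⟨hw, χ, hχ, hk⟩
    refine ⟨?_, fun t _ => hw _, fun t => χ (t + a), (hconv hχ).1, (hconv hχ).2, ?_⟩
    · simp only [zero_add]; rw [add_comm, hT]
    · simp only [zero_add]; rw [add_comm T, hk]; ring

/-- A ray from the origin that avoids a set witnesses that the component of the origin in the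
complement is unbounded. -/
theorem not_isBounded_component_of_ray {S : Set ℂ} {v : ℂ} (hv : v ≠ 0)
    (hS : ∀ s : ℝ, 0 ≤ s → (s : ℂ) * v ∉ S) :
    ¬ Bornology.IsBounded (connectedComponentIn Sᶜ 0) := by
  intro hb
  have hsub : (fun s : ℝ => (s : ℂ) * v) '' Set.Ici 0 ⊆ connectedComponentIn Sᶜ 0 := by
    refine IsPreconnected.subset_connectedComponentIn ?_ ⟨0, Set.self_mem_Ici, by simp⟩ ?_
    · exact isPreconnected_Ici.image _ (by fun_prop)
    · rintro _ ⟨s, hs, rfl⟩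
      exact hS s hs
  obtain ⟨C, hC⟩ := (hb.subset hsub).exists_norm_le
  have hv' : 0 < ‖v‖ := norm_pos_iff.2 hv
  have := hC _ ⟨(|C| + 1) / ‖v‖, Set.mem_Ici.2 (by positivity), rfl⟩
  rw [norm_mul, Complex.norm_real, Real.norm_eq_abs, abs_of_nonneg (by positivity),
    div_mul_cancel₀ _ hv'.ne'] at this
  linarith [le_abs_self C]

/-! ### Orbits that are symmetric about the real axis -/

/-- A closed path that is symmetric about the real axis, meets it only twice per period, and runs
through the upper half-plane with decreasing distance to the origin. -/
structure IsOval (Z : ℝ → ℂ) (T : ℝ) : Prop where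
  continuous : Continuous Z
  pos : 0 < T
  periodic : Function.Periodic Z T
  reflect : ∀ t, Z (-t) = (starRingEnd ℂ) (Z t)
  im_pos : ∀ t ∈ Set.Ioo 0 (T / 2), 0 < (Z t).im
  strictAntiOn_norm : StrictAntiOn (fun t => ‖Z t‖) (Set.Icc 0 (T / 2))

namespace IsOval

variable {Z : ℝ → ℂ} {T : ℝ}

theorem im_zero (h : IsOval Z T) : (Z 0).im = 0 := by
  have := congrArg Complex.im (h.reflect 0)
  rw [neg_zero, Complex.conj_im] at this
  linarith

theorem im_half (h : IsOval Z T) : (Z (T / 2)).im = 0 := by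
  have h1 := congrArg Complex.im (h.reflect (T / 2))
  have h2 : Z (-(T / 2)) = Z (T / 2) := by
    rw [← h.periodic (-(T / 2))]; congr 1; ring
  rw [h2, Complex.conj_im] at h1
  linarith

theorem norm_half_lt (h : IsOval Z T) : ‖Z (T / 2)‖ < ‖Z 0‖ :=
  h.strictAntiOn_norm ⟨le_rfl, by linarith [h.pos]⟩ ⟨by linarith [h.pos], le_rfl⟩
    (by linarith [h.pos])

theorem exists_half (h : IsOval Z T) (t : ℝ) :
    ∃ s ∈ Set.Icc 0 (T / 2), Z t = Z s ∨ Z t = (starRingEnd ℂ) (Z s) := by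
  obtain ⟨s, hs, hst⟩ := h.periodic.exists_mem_Ico₀ h.pos t
  rcases le_total s (T / 2) with hle | hle
  · exact ⟨s, ⟨hs.1, hle⟩, Or.inl hst⟩
  · refine ⟨T - s, ⟨by linarith [hs.2], by linarith⟩, Or.inr ?_⟩
    rw [hst, ← h.reflect, ← h.periodic (-(T - s))]
    congr 1; ring

theorem eq_of_im_eq_zero (h : IsOval Z T) {t : ℝ} (ht : (Z t).im = 0) :
    Z t = Z 0 ∨ Z t = Z (T / 2) := by
  obtain ⟨s, hs, hst⟩ := h.exists_half t
  have him : (Z s).im = 0 := by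
    rcases hst with e | e <;> rw [e] at ht
    · exact ht
    · simpa using ht
  have hZ : Z t = Z s := by
    rcases hst with e | e
    · exact e
    · rw [e, Complex.conj_eq_iff_im.2 him]
  rcases eq_or_lt_of_le hs.1 with rfl | h0
  · exact Or.inl hZ
  rcases eq_or_lt_of_le hs.2 with rfl | h1
  · exact Or.inr hZ
  · exact absurd him (h.im_pos s ⟨h0, h1⟩).ne'

/-- The real part is a function of the distance to the origin. -/
theorem re_eq_of_norm_eq (h : IsOval Z T) {t t' : ℝ} (ht : ‖Z t‖ = ‖Z t'‖) :
    (Z t).re = (Z t').re := by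
  obtain ⟨s, hs, hst⟩ := h.exists_half t
  obtain ⟨s', hs', hst'⟩ := h.exists_half t'
  have n1 : ‖Z t‖ = ‖Z s‖ := by rcases hst with e | e <;> rw [e]; simp
  have n2 : ‖Z t'‖ = ‖Z s'‖ := by rcases hst' with e | e <;> rw [e]; simp
  have r1 : (Z t).re = (Z s).re := by rcases hst with e | e <;> rw [e]; simp
  have r2 : (Z t').re = (Z s').re := by rcases hst' with e | e <;> rw [e]; simp
  have : s = s' := h.strictAntiOn_norm.injOn hs hs' (by rw [← n1, ← n2, ht])
  rw [r1, r2, this]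

/-- The argument seen from a real point is odd up to a constant; hence half of its growth over a
period occurs in the upper half-plane. -/
theorem arg_half (h : IsOval Z T) {w : ℝ} {χ : ℝ → ℝ} {k : ℤ} (hw : ∀ t, Z t ≠ w)
    (hχ : IsArgOn (fun t => Z t - (w : ℂ)) χ Set.univ)
    (hk : ∀ t, χ (t + T) = χ t + 2 * Real.pi * k) : χ (T / 2) = χ 0 + Real.pi * k := by
  have hs : IsArgOn (fun t => Z t - (w : ℂ)) (fun t => -χ (-t)) Set.univ := by
    refine ⟨(hχ.1.comp (by fun_prop) (fun _ _ => Set.mem_univ _) :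
      ContinuousOn (χ ∘ fun t => -t) Set.univ).neg, fun t _ => ?_⟩
    have := congrArg (starRingEnd ℂ) (hχ.2 (-t) trivial)
    simp only [h.reflect, map_sub, map_mul, Complex.conj_conj, Complex.conj_ofReal,
      ← Complex.exp_conj, Complex.conj_I] at this
    refine this.trans ?_
    rw [show (starRingEnd ℂ) (Z t) - (w : ℂ) = (starRingEnd ℂ) (Z t - (w : ℂ)) by simp,
      Complex.norm_conj]
    push_cast
    ring_nf
  obtain ⟨m, hm⟩ := IsArgOn.sub_const isPreconnected_univ hχ hs (β := 0) (fun _ => 1)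
    (fun t _ => sub_ne_zero.2 (hw t)) (fun _ _ => one_pos) (fun t _ => by simp)
  have e1 := hm 0 trivial
  have e2 := hm (T / 2) trivial
  have e3 := hk (-(T / 2))
  rw [show -(T / 2) + T = T / 2 by ring] at e3
  simp only [neg_zero] at e1
  linarith

/-- Seen from a real point between the two real points of the path, the path winds once,
counter-clockwise if the outer one lies to the right. -/
theorem isWinding_of_between (h : IsOval Z T) {σ : ℤ} (hσ : σ = 1 ∨ σ = -1) {w : ℝ}
    (h0 : 0 < (σ : ℝ) * ((Z 0).re - w)) (h1 : (σ : ℝ) * ((Z (T / 2)).re - w) < 0) :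
    IsWinding Z T w σ := by
  have z0 : Z 0 = ((Z 0).re : ℂ) := Complex.ext rfl (by simp [h.im_zero])
  have z1 : Z (T / 2) = ((Z (T / 2)).re : ℂ) := Complex.ext rfl (by simp [h.im_half])
  have hw : ∀ t, Z t ≠ w := by
    intro t ht
    rcases h.eq_of_im_eq_zero (t := t) (by rw [ht]; simp) with e | e
    · rw [← e, ht] at h0; simp at h0
    · rw [← e, ht] at h1; simp at h1
  obtain ⟨k, hk⟩ := exists_isWinding h.continuous h.periodic hw
  have hk' := hk
  obtain ⟨-, χ, hχ, hχk⟩ := hk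
  have hhalf := h.arg_half hw hχ hχk
  have hσ2 : (σ : ℝ) * σ = 1 := by rcases hσ with rfl | rfl <;> norm_num
  have e0 : Complex.exp (Complex.I * (χ 0 : ℂ)) = ((σ : ℝ) : ℂ) := by
    refine exp_arg_real (x := (Z 0).re - w) h0 hσ2 ?_
    have := hχ.2 0 trivial
    simp only at this
    rw [z0] at this
    push_cast
    exact this
  have e1 : Complex.exp (Complex.I * (χ (T / 2) : ℂ)) = ((-σ : ℝ) : ℂ) := by
    refine exp_arg_real (x := (Z (T / 2)).re - w) (by linarith) (by linarith) ?_
    have := hχ.2 (T / 2) trivial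
    simp only at this
    rw [z1] at this
    push_cast
    exact this
  have hodd : Odd k := by
    rw [← Int.not_even_iff_odd]
    rintro ⟨m, rfl⟩
    rw [exp_I_mul_eq_iff.2 ⟨m, (by rw [hhalf]; push_cast; ring : _ = χ 0 + _)⟩, e0] at e1
    have : (σ : ℝ) = -σ := by exact_mod_cast e1
    have : (σ : ℝ) = 0 := by linarith
    rw [this] at hσ2
    norm_num at hσ2
  have hsin : ∀ t ∈ Set.Icc 0 (T / 2), 0 ≤ Real.sin (χ t) := by
    intro t ht
    have him : 0 ≤ (Z t).im := by
      rcases eq_or_lt_of_le ht.1 with rfl | ht0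
      · rw [h.im_zero]
      rcases eq_or_lt_of_le ht.2 with rfl | ht1
      · rw [h.im_half]
      · exact (h.im_pos t ⟨ht0, ht1⟩).le
    have e := congrArg Complex.im (hχ.2 t trivial)
    simp only at e
    rw [mul_comm Complex.I, Complex.im_ofReal_mul, Complex.exp_ofReal_mul_I_im, Complex.sub_im,
      Complex.ofReal_im, sub_zero] at e
    have hpos : 0 < ‖Z t - (w : ℂ)‖ := norm_pos_iff.2 (sub_ne_zero.2 (hw t))
    by_contra hcon
    nlinarith [not_le.1 hcon]
  have hsin' : ∀ t, Real.sin (σ * (χ t - χ 0)) = Real.sin (χ t) := by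
    intro t
    have hc : Real.cos (χ 0) = σ := by
      have := congrArg Complex.re e0
      rwa [mul_comm, Complex.exp_ofReal_mul_I_re, Complex.ofReal_re] at this
    have hs : Real.sin (χ 0) = 0 := by
      have := congrArg Complex.im e0
      rwa [mul_comm, Complex.exp_ofReal_mul_I_im, Complex.ofReal_im] at this
    have e2 : Real.sin (χ t - χ 0) = σ * Real.sin (χ t) := by
      rw [Real.sin_sub, hc, hs]; ring
    rcases hσ with rfl | rfl
    · simpa using e2
    · push_cast at e2 ⊢
      rw [neg_one_mul, Real.sin_neg, e2]; ring
  have key := eq_one_of_sin_nonneg (Y := fun t => σ * (χ t - χ 0)) (a := T / 2)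
    (k := σ * k) (by linarith [h.pos])
    (continuousOn_const.mul ((hχ.1.mono (Set.subset_univ _)).sub continuousOn_const))
    (fun t ht => by rw [hsin']; exact hsin t ht) (by simp)
    (by rcases hσ with rfl | rfl
        · simpa using hodd
        · simpa using hodd.neg)
    (by rw [hhalf]; push_cast; ring)
  have : k = σ := by rcases hσ with rfl | rfl <;> omega
  rwa [this] at hk'

/-- Seen from a real point that is not between the two real points of the path, the winding number
is even. -/
theorem even_of_not_between (h : IsOval Z T) {w ε : ℝ} (hε : ε * ε = 1) {k : ℤ}
    (hk : IsWinding Z T w k) (h0 : 0 < ε * ((Z 0).re - w)) (h1 : 0 < ε * ((Z (T / 2)).re - w)) :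
    Even k := by
  have z0 : Z 0 = ((Z 0).re : ℂ) := Complex.ext rfl (by simp [h.im_zero])
  have z1 : Z (T / 2) = ((Z (T / 2)).re : ℂ) := Complex.ext rfl (by simp [h.im_half])
  obtain ⟨hw, χ, hχ, hχk⟩ := hk
  have hhalf := h.arg_half hw hχ hχk
  have e0 : Complex.exp (Complex.I * (χ 0 : ℂ)) = (ε : ℂ) := by
    refine exp_arg_real (x := (Z 0).re - w) h0 hε ?_
    have := hχ.2 0 trivial
    simp only at this
    rw [z0] at this
    push_cast
    exact this
  have e1 : Complex.exp (Complex.I * (χ (T / 2) : ℂ)) = (ε : ℂ) := by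
    refine exp_arg_real (x := (Z (T / 2)).re - w) h1 hε ?_
    have := hχ.2 (T / 2) trivial
    simp only at this
    rw [z1] at this
    push_cast
    exact this
  obtain ⟨m, hm⟩ := exp_I_mul_eq_iff.1 (e1.trans e0.symm)
  refine ⟨m, ?_⟩
  have h2 : Real.pi * (k : ℝ) = Real.pi * (m + m) := by linarith
  have := mul_left_cancel₀ Real.pi_pos.ne' h2
  exact_mod_cast this

/-- If the outer real point lies to the left, then the path winds once counter-clockwise around no
point. A point `w` is moved along the circle `|z| = |w|` to the real axis, away from the only
abscissa at which this circle meets the path; for real points the claim is known. -/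
theorem not_isWinding_one (h : IsOval Z T) (hneg : (Z 0).re < 0) (w : ℂ) :
    ¬ IsWinding Z T w 1 := by
  have hreal : ∀ x : ℝ, ¬ IsWinding Z T x 1 := by
    intro x hx
    have hlt : (Z 0).re < (Z (T / 2)).re := by
      have h1 := h.norm_half_lt
      have h2 := Complex.abs_re_le_norm (Z (T / 2))
      have z0 : Z 0 = ((Z 0).re : ℂ) := Complex.ext rfl (by simp [h.im_zero])
      rw [z0, Complex.norm_real, Real.norm_eq_abs, abs_of_neg hneg] at h1
      linarith [neg_abs_le (Z (T / 2)).re]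
    have z0 : Z 0 = ((Z 0).re : ℂ) := Complex.ext rfl (by simp [h.im_zero])
    have z1 : Z (T / 2) = ((Z (T / 2)).re : ℂ) := Complex.ext rfl (by simp [h.im_half])
    have n0 : (Z 0).re ≠ x := fun e => hx.1 0 (by rw [z0, e])
    have n1 : (Z (T / 2)).re ≠ x := fun e => hx.1 (T / 2) (by rw [z1, e])
    rcases lt_or_gt_of_ne n0 with c0 | c0
    · rcases lt_or_gt_of_ne n1 with c1 | c1
      · have := h.even_of_not_between (ε := -1) (by norm_num) hx (by linarith) (by linarith)
        exact absurd this (by decide)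
      · have := h.isWinding_of_between (σ := -1) (w := x) (Or.inr rfl) (by push_cast; linarith)
          (by push_cast; linarith)
        exact absurd (IsWinding.unique h.continuous h.periodic hx this) (by decide)
    · have := h.even_of_not_between (ε := 1) (by norm_num) hx (by linarith) (by linarith)
      exact absurd this (by decide)
  intro hw
  set R := ‖w‖ with hR
  obtain ⟨ε, hε, hwε⟩ : ∃ ε : ℝ, ε * ε = 1 ∧ w.im = ε * Real.sqrt (R ^ 2 - w.re ^ 2) := by
    have e : R ^ 2 - w.re ^ 2 = w.im ^ 2 := by
      rw [hR, ← Complex.normSq_eq_norm_sq, Complex.normSq_apply]; ring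
    rw [e, Real.sqrt_sq_eq_abs]
    rcases le_total 0 w.im with h0 | h0
    · exact ⟨1, by norm_num, by rw [abs_of_nonneg h0, one_mul]⟩
    · exact ⟨-1, by norm_num, by rw [abs_of_nonpos h0]; ring⟩
  have hre := abs_le.1 (Complex.abs_re_le_norm w)
  -- the arc of the circle `|z| = R` through `w`, by abscissa
  set arc : ℝ → ℂ := fun x => (x : ℂ) + ((ε * Real.sqrt (R ^ 2 - x ^ 2) : ℝ) : ℂ) * Complex.I
    with harc
  have arc_re : ∀ x, (arc x).re = x := fun x => by simp [harc]
  have arc_im : ∀ x, (arc x).im = ε * Real.sqrt (R ^ 2 - x ^ 2) := fun x => by simp [harc]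
  have arc_norm : ∀ x, -R ≤ x → x ≤ R → ‖arc x‖ = R := by
    intro x h1 h2
    have e : 0 ≤ R ^ 2 - x ^ 2 := by nlinarith
    have : ‖arc x‖ ^ 2 = R ^ 2 := by
      rw [← Complex.normSq_eq_norm_sq, Complex.normSq_apply, arc_re, arc_im]
      linear_combination (Real.sqrt (R ^ 2 - x ^ 2)) ^ 2 * hε + Real.sq_sqrt e
    exact (sq_eq_sq₀ (norm_nonneg _) (norm_nonneg _)).1 this
  have arc_w : arc w.re = w := Complex.ext (arc_re _) ((arc_im _).trans hwε.symm)
  have arc_cont : Continuous arc := by fun_prop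
  have harcR : ∀ x, x ^ 2 = R ^ 2 → arc x = (x : ℂ) := fun x hx => by simp [harc, hx]
  obtain ⟨e, he, heR, hoff⟩ : ∃ e : ℝ, e ^ 2 = R ^ 2 ∧ |e| ≤ R ∧
      ∀ x ∈ Set.uIcc w.re e, ∀ t, Z t ≠ arc x := by
    have hRn : 0 ≤ R := norm_nonneg _
    by_cases hex : ∃ t₀, ‖Z t₀‖ = R
    · obtain ⟨t₀, ht₀⟩ := hex
      have hq : ∀ x, -R ≤ x → x ≤ R → ∀ t, Z t = arc x → x = (Z t₀).re := by
        intro x h1 h2 t ht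
        rw [← arc_re x, ← ht]
        exact h.re_eq_of_norm_eq (by rw [ht, arc_norm x h1 h2, ht₀])
      have hne : w.re ≠ (Z t₀).re := by
        intro hcon
        have him : (Z t₀).im ^ 2 = w.im ^ 2 := by
          have h1 : ‖Z t₀‖ ^ 2 = ‖w‖ ^ 2 := by rw [ht₀]
          rw [← Complex.normSq_eq_norm_sq, ← Complex.normSq_eq_norm_sq, Complex.normSq_apply,
            Complex.normSq_apply, hcon] at h1
          linarith
        rcases sq_eq_sq_iff_eq_or_eq_neg.1 him with h1 | h1
        · exact hw.1 t₀ (Complex.ext hcon.symm h1)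
        · refine hw.1 (-t₀) ?_
          rw [h.reflect]
          exact Complex.ext (by simp [hcon]) (by simp [h1])
      rcases lt_or_gt_of_ne hne with hlt | hgt
      · refine ⟨-R, by ring, by rw [abs_neg, abs_of_nonneg hRn], fun x hx t ht => ?_⟩
        rw [Set.uIcc_of_ge hre.1] at hx
        have := hq x hx.1 (hx.2.trans hre.2) t ht
        linarith [hx.2]
      · refine ⟨R, rfl, by rw [abs_of_nonneg hRn], fun x hx t ht => ?_⟩
        rw [Set.uIcc_of_le hre.2] at hx
        have := hq x (hre.1.trans hx.1) hx.2 t ht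
        linarith [hx.1]
    · refine ⟨R, rfl, by rw [abs_of_nonneg hRn], fun x hx t ht => hex ⟨t, ?_⟩⟩
      rw [Set.uIcc_of_le hre.2] at hx
      rw [ht, arc_norm x (hre.1.trans hx.1) hx.2]
  -- the motion from `w` to `e`, made constant outside the time interval `[0, 1]`
  set γ : ℝ → ℂ := fun s => arc (w.re + max 0 (min 1 s) * (e - w.re)) with hγ
  have hγc : Continuous γ := by fun_prop
  have hγoff : ∀ s t, Z t ≠ γ s := by
    intro s t
    refine hoff _ ?_ t
    have h1 : 0 ≤ max 0 (min 1 s) := le_max_left _ _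
    have h2 : max 0 (min 1 s) ≤ 1 := max_le zero_le_one (min_le_left _ _)
    rw [← segment_eq_uIcc, segment_eq_image']
    exact ⟨_, ⟨h1, h2⟩, by simp⟩
  have g0 : γ 0 = w := by simp [hγ, arc_w]
  have g1 : γ 1 = (e : ℂ) := by
    rw [← harcR e he]; simp [hγ]
  have hwe : ∀ t, Z t ≠ (e : ℂ) := fun t => g1 ▸ hγoff 1 t
  obtain ⟨k, hk⟩ := exists_isWinding h.continuous h.periodic hwe
  have h1k : (1 : ℤ) = k := IsWinding.homotopy h.continuous h.periodic hγc hγoff (a := 0) (b := 1)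
    (by rwa [g0]) (by rwa [g1])
  exact hreal e (h1k ▸ hk)

/-- If both real points of the path are on the same side of the origin, then the origin lies in an
unbounded component of the complement. -/
theorem not_isBounded_component (h : IsOval Z T) {ε : ℝ} (hε : ε * ε = 1)
    (h0 : 0 < ε * (Z 0).re) (h1 : 0 < ε * (Z (T / 2)).re) :
    ¬ Bornology.IsBounded (connectedComponentIn (Set.range Z)ᶜ 0) := by
  have hε0 : ε ≠ 0 := by rintro rfl; norm_num at hε
  refine not_isBounded_component_of_ray (v := ((-ε : ℝ) : ℂ)) (by simpa using hε0) ?_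
  rintro s hs ⟨t, ht⟩
  have hre : ε * (Z t).re = -s := by
    rw [ht, ← Complex.ofReal_mul, Complex.ofReal_re]; linear_combination (-s) * hε
  rcases h.eq_of_im_eq_zero (t := t) (by rw [ht]; simp) with e | e <;> rw [e] at hre <;> linarith

end IsOval

/-! ### The orbit of a closed solution -/

/-- A solution of `κ = f(r)` that is a simple closed curve of length `L`, parametrized on the
whole line. -/
structure IsClosedSolution (f : ℝ → ℝ) (c u : ℝ → ℂ) (κ : ℝ → ℝ) (L : ℝ) : Prop extends
    IsGlobalSolution f c u κ where
  pos : 0 < L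
  periodic : Function.Periodic c L
  inj : ∀ s t, c s = c t → ∃ k : ℤ, t = s + k * L

/-- The ODE is reversible: complex conjugation maps flow lines to reversed flow lines. -/
theorem IsFlowLine.reverse {f : ℝ → ℝ} {η : ℝ → ℂ} (hη : IsFlowLine f η) :
    IsFlowLine f (fun t => (starRingEnd ℂ) (η (-t))) where
  continuous := Complex.continuous_conj.comp (hη.continuous.comp continuous_neg)
  hasDerivAt t ht := by
    have h0 : η (-t) ≠ 0 := by simpa using ht
    have h1 := ((hη.hasDerivAt (-t) h0).scomp t (hasDerivAt_neg t)).star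
    refine h1.congr_deriv ?_
    simp only [field, neg_smul, one_smul, Complex.norm_conj, star_neg, star_sub, star_mul',
      Complex.star_def, Complex.conj_I, Complex.conj_ofReal]
    ring
  dense := by
    have := hη.dense.preimage (Homeomorph.neg ℝ).isOpenMap
    simpa using this

namespace IsGlobalSolution

variable {f : ℝ → ℝ} {c u : ℝ → ℂ} {κ : ℝ → ℝ}

theorem movingPath_reflect (hf : ContDiffOn ℝ ∞ f (Set.Ioi 0)) (h : IsGlobalSolution f c u κ)
    (h0 : (movingPath c u 0).im = 0) (t : ℝ) :
    movingPath c u (-t) = (starRingEnd ℂ) (movingPath c u t) := by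
  have h1 := congrFun (h.eq_movingPath hf h.isFlowLine_movingPath.reverse
    (by simpa using Complex.conj_eq_iff_im.2 h0)) (-t)
  simpa using h1.symm

theorem exists_tangentAngle (h : IsGlobalSolution f c u κ) :
    ∃ θ : ℝ → ℝ, (∀ t, HasDerivAt θ (κ t) t) ∧
      ∀ t, u t = Complex.exp (Complex.I * (θ t : ℂ)) := by
  have hκ : Continuous κ := h.contDiff_curvature.continuous
  set θ : ℝ → ℝ := fun t => (u 0).arg + ∫ s in (0 : ℝ)..t, κ s with hθ
  have hd : ∀ t, HasDerivAt θ (κ t) t := fun t =>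
    (intervalIntegral.integral_hasDerivAt_right (hκ.intervalIntegrable _ _)
      (hκ.stronglyMeasurableAtFilter _ _) hκ.continuousAt).const_add _
  refine ⟨θ, hd, ?_⟩
  have he : ∀ t, HasDerivAt (fun t => u t * Complex.exp (-(Complex.I * (θ t : ℂ)))) 0 t := by
    intro t
    have h1 : HasDerivAt (fun t => -(Complex.I * (θ t : ℂ))) (-(Complex.I * (κ t : ℂ))) t :=
      ((hd t).ofReal_comp.const_mul _).neg
    refine ((h.hasDerivAt_tangent t).mul h1.cexp).congr_deriv ?_
    ring
  have hconst := is_const_of_deriv_eq_zero (fun t => (he t).differentiableAt) fun t => (he t).deriv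
  intro t
  have h1 := hconst t 0
  have h2 : u 0 = Complex.exp (Complex.I * (θ 0 : ℂ)) := by
    have := Complex.norm_mul_exp_arg_mul_I (u 0)
    rw [h.norm_tangent, Complex.ofReal_one, one_mul] at this
    simp only [hθ, intervalIntegral.integral_same, add_zero]
    rw [mul_comm, this]
  have h3 : u 0 * Complex.exp (-(Complex.I * (θ 0 : ℂ))) = 1 := by
    rw [h2, ← Complex.exp_add]; simp
  rw [h3] at h1
  have h4 := congrArg (· * Complex.exp (Complex.I * (θ t : ℂ))) h1
  simp only [mul_assoc, ← Complex.exp_add, neg_add_cancel, Complex.exp_zero, mul_one,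
    one_mul] at h4
  exact h4

theorem hasDerivAt_norm_sq (h : IsGlobalSolution f c u κ) (t : ℝ) :
    HasDerivAt (fun t => ‖movingPath c u t‖ ^ 2) (-2 * (movingPath c u t).im) t := by
  have hd := h.hasDerivAt_movingPath t
  have hre : HasDerivAt (fun t => (movingPath c u t).re) _ t :=
    Complex.reCLM.hasFDerivAt.comp_hasDerivAt t hd
  have him : HasDerivAt (fun t => (movingPath c u t).im) _ t :=
    Complex.imCLM.hasFDerivAt.comp_hasDerivAt t hd
  have := (hre.mul hre).add (him.mul him)
  have he : (fun t => ‖movingPath c u t‖ ^ 2) = fun t => (movingPath c u t).re *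
      (movingPath c u t).re + (movingPath c u t).im * (movingPath c u t).im := by
    funext t; rw [← Complex.normSq_eq_norm_sq, Complex.normSq_apply]
  rw [he]
  refine this.congr_deriv ?_
  simp
  ring

theorem eq_conj_movingPath (h : IsGlobalSolution f c u κ) (t : ℝ) :
    c t = -Complex.I * (starRingEnd ℂ) (movingPath c u t) * u t := by
  simp only [movingPath, map_mul, map_neg, Complex.conj_I, Complex.conj_conj]
  linear_combination (-c t) * h.tangent_mul_conj t + c t * u t * (starRingEnd ℂ) (u t) *
    Complex.I_mul_I

theorem curvature_periodic (h : IsGlobalSolution f c u κ) {T : ℝ}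
    (hT : Function.Periodic (movingPath c u) T) : Function.Periodic κ T := by
  have hκ : Continuous κ := h.contDiff_curvature.continuous
  refine congrFun (Continuous.ext_on h.isFlowLine_movingPath.dense
    (f := fun t => κ (t + T)) (by fun_prop) hκ fun t ht => ?_)
  have ht' : movingPath c u t ≠ 0 := ht
  have hne : c t ≠ 0 := fun h0 => ht' ((h.movingPath_eq_zero_iff t).2 h0)
  have hne' : c (t + T) ≠ 0 := fun h0 => ht' (by
    rw [← hT t]; exact (h.movingPath_eq_zero_iff _).2 h0)
  simp only
  rw [h.curvature_eq t hne, h.curvature_eq _ hne', ← h.norm_movingPath, ← h.norm_movingPath, hT t]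

/-- Over a period of the moving path the tangent turns by a fixed angle, and the curve is rotated
about the origin by the same angle. -/
theorem exists_rotation (h : IsGlobalSolution f c u κ) {T : ℝ}
    (hT : Function.Periodic (movingPath c u) T) {θ : ℝ → ℝ} (hθ : ∀ t, HasDerivAt θ (κ t) t)
    (hu : ∀ t, u t = Complex.exp (Complex.I * (θ t : ℂ))) :
    ∃ α : ℝ, (∀ t, θ (t + T) = θ t + α) ∧
      ∀ t, c (t + T) = Complex.exp (Complex.I * (α : ℂ)) * c t := by
  have hκ := h.curvature_periodic hT
  have hd : ∀ t, HasDerivAt (fun t => θ (t + T) - θ t) 0 t := fun t =>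
    (((hθ (t + T)).comp_add_const t T).sub (hθ t)).congr_deriv (by rw [hκ t, sub_self])
  have hc := is_const_of_deriv_eq_zero (fun t => (hd t).differentiableAt) fun t => (hd t).deriv
  refine ⟨θ (0 + T) - θ 0, fun t => by linarith [hc t 0], fun t => ?_⟩
  have h1 : θ (t + T) = θ t + (θ (0 + T) - θ 0) := by linarith [hc t 0]
  rw [h.eq_conj_movingPath (t + T), hT t, hu, h1, h.eq_conj_movingPath t, hu t]
  push_cast
  rw [mul_add, Complex.exp_add]
  ring

/-- A periodic moving path that is not constant has a minimal period. -/
theorem exists_minimal_period (hf : ContDiffOn ℝ ∞ f (Set.Ioi 0)) (h : IsGlobalSolution f c u κ)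
    {L : ℝ} (hL : 0 < L) (hper : Function.Periodic (movingPath c u) L)
    (hne : ¬ ∀ t, movingPath c u t = movingPath c u 0) :
    ∃ T > 0, Function.Periodic (movingPath c u) T ∧
      ∀ s t, movingPath c u s = movingPath c u t → ∃ k : ℤ, t = s + k * T := by
  -- a closed subgroup of the line that is not everything is cyclic
  set P : AddSubgroup ℝ :=
    { carrier := {T | Function.Periodic (movingPath c u) T}
      add_mem' := fun ha hb => ha.add_period hb
      zero_mem' := fun t => by rw [add_zero]
      neg_mem' := fun ha => ha.neg } with hP
  have hret : ∀ s t, movingPath c u s = movingPath c u t → t - s ∈ P := by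
    intro s t hst x
    have := h.movingPath_add_eq hf hst (x - s)
    rw [sub_add_cancel] at this
    rw [this]
    congr 1; ring
  have hclosed : IsClosed (P : Set ℝ) := by
    have : (P : Set ℝ) = ⋂ t, {T | movingPath c u (t + T) = movingPath c u t} := by
      ext T; simp [hP, Function.Periodic]
    rw [this]
    have := h.continuous_movingPath
    exact isClosed_iInter fun t => isClosed_eq (by fun_prop) continuous_const
  have hnd : ¬ Dense (P : Set ℝ) := by
    intro hd
    have : (P : Set ℝ) = Set.univ := by rw [← hclosed.closure_eq]; exact hd.closure_eq
    refine hne fun t => ?_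
    have ht : t ∈ (P : Set ℝ) := this ▸ Set.mem_univ t
    simpa using ht 0
  obtain ⟨a, ha⟩ := P.dense_or_cyclic.resolve_left hnd
  have ha0 : a ≠ 0 := by
    rintro rfl
    have h1 : L ∈ P := hper
    rw [ha, AddSubgroup.mem_closure_singleton] at h1
    obtain ⟨n, hn⟩ := h1
    simp at hn
    exact hL.ne hn
  have haP : |a| ∈ P := by
    have h1 : a ∈ P := by rw [ha]; exact AddSubgroup.mem_closure_singleton_self a
    rcases abs_choice a with e | e <;> rw [e]
    · exact h1
    · exact P.neg_mem h1
  refine ⟨|a|, abs_pos.2 ha0, haP, fun s t hst => ?_⟩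
  have h1 := hret s t hst
  rw [ha, AddSubgroup.mem_closure_singleton] at h1
  obtain ⟨n, hn⟩ := h1
  rw [zsmul_eq_mul] at hn
  rcases abs_choice a with e | e <;> rw [e]
  · exact ⟨n, by linarith⟩
  · exact ⟨-n, by push_cast; linarith⟩

/-- Started at a point farthest from the origin, the moving path is real there, by
`hasDerivAt_norm_sq`; since the ODE is reversible, the path is symmetric about the real axis, and
it is real at multiples of half a period only. -/
theorem isOval (hf : ContDiffOn ℝ ∞ f (Set.Ioi 0)) (h : IsGlobalSolution f c u κ)
    (hmax : ∀ t, ‖c t‖ ≤ ‖c 0‖) {T : ℝ} (hT0 : 0 < T) (hT : Function.Periodic (movingPath c u) T)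
    (hmin : ∀ s t, movingPath c u s = movingPath c u t → ∃ k : ℤ, t = s + k * T) :
    IsOval (movingPath c u) T := by
  have him0 : (movingPath c u 0).im = 0 := by
    have hloc : IsLocalMax (fun t => ‖movingPath c u t‖ ^ 2) 0 :=
      Filter.Eventually.of_forall fun t => by
        simp only [h.norm_movingPath]
        exact pow_le_pow_left₀ (norm_nonneg _) (hmax t) 2
    have := hloc.hasDerivAt_eq_zero (h.hasDerivAt_norm_sq 0)
    linarith
  have hrefl := h.movingPath_reflect hf him0
  have hreal : ∀ t ∈ Set.Ioo 0 (T / 2), (movingPath c u t).im ≠ 0 := by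
    intro t ht h0
    have h1 : movingPath c u (-t) = movingPath c u t := by
      rw [hrefl, Complex.conj_eq_iff_im.2 h0]
    obtain ⟨k, hk⟩ := hmin _ _ h1
    have h2 : 2 * t = k * T := by linarith
    have h3 : (0 : ℝ) < k := by
      by_contra hcon
      nlinarith [not_lt.1 hcon, ht.1]
    have h4 : (1 : ℝ) ≤ k := by
      have : (0 : ℤ) < k := by exact_mod_cast h3
      exact_mod_cast (show (1 : ℤ) ≤ k by omega)
    nlinarith [ht.2]
  have hcont : Continuous fun t => (movingPath c u t).im :=
    Complex.continuous_im.comp h.continuous_movingPath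
  have hsq : Continuous fun t => ‖movingPath c u t‖ ^ 2 := h.continuous_movingPath.norm.pow 2
  have hpos : ∀ t ∈ Set.Ioo 0 (T / 2), 0 < (movingPath c u t).im := by
    intro t ht
    by_contra hcon
    have hneg : ∀ s ∈ Set.Ioo 0 (T / 2), (movingPath c u s).im < 0 := by
      intro s hs
      by_contra hs'
      obtain ⟨x, hx, hx0⟩ := isPreconnected_Ioo.intermediate_value ht hs hcont.continuousOn
        (show (0 : ℝ) ∈ Set.Icc _ _ from ⟨not_lt.1 hcon, not_lt.1 hs'⟩)
      exact hreal x hx hx0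
    have hmono : StrictMonoOn (fun t => ‖movingPath c u t‖ ^ 2) (Set.Icc 0 (T / 2)) := by
      refine strictMonoOn_of_deriv_pos (convex_Icc _ _) hsq.continuousOn fun s hs => ?_
      rw [interior_Icc] at hs
      rw [(h.hasDerivAt_norm_sq s).deriv]
      linarith [hneg s hs]
    have h1 := hmono (Set.left_mem_Icc.2 (by linarith)) (Set.right_mem_Icc.2 (by linarith))
      (show (0 : ℝ) < T / 2 by linarith)
    simp only [h.norm_movingPath] at h1
    have := pow_le_pow_left₀ (norm_nonneg _) (hmax (T / 2)) 2
    linarith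
  refine ⟨h.continuous_movingPath, hT0, hT, hrefl, hpos, ?_⟩
  have hanti : StrictAntiOn (fun t => ‖movingPath c u t‖ ^ 2) (Set.Icc 0 (T / 2)) := by
    refine strictAntiOn_of_deriv_neg (convex_Icc _ _) hsq.continuousOn fun s hs => ?_
    rw [interior_Icc] at hs
    rw [(h.hasDerivAt_norm_sq s).deriv]
    linarith [hpos s hs]
  intro s hs t ht hst
  exact lt_of_pow_lt_pow_left₀ 2 (norm_nonneg _) (hanti hs ht hst)

end IsGlobalSolution

namespace IsClosedSolution

variable {f : ℝ → ℝ} {c u : ℝ → ℂ} {κ : ℝ → ℝ} {L : ℝ}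

theorem shift (h : IsClosedSolution f c u κ L) (a : ℝ) :
    IsClosedSolution f (fun t => c (t + a)) (fun t => u (t + a)) (fun t => κ (t + a)) L where
  toIsGlobalSolution := h.toIsGlobalSolution.shift a
  pos := h.pos
  periodic := h.periodic.add_const a
  inj s t hst := by
    obtain ⟨k, hk⟩ := h.inj _ _ hst
    exact ⟨k, by linarith⟩

theorem tangent_periodic (h : IsClosedSolution f c u κ L) : Function.Periodic u L := fun t => by
  have h1 := (h.hasDerivAt (t + L)).comp_add_const t L
  rw [show (fun t => c (t + L)) = c from funext h.periodic] at h1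
  exact h1.unique (h.hasDerivAt t)

theorem movingPath_periodic (h : IsClosedSolution f c u κ L) :
    Function.Periodic (movingPath c u) L := fun t => by
  rw [movingPath, h.periodic, h.tangent_periodic, movingPath]

theorem countable_zeros (h : IsClosedSolution f c u κ L) : {t | c t = 0}.Countable := by
  by_cases hex : ∃ t₀, c t₀ = 0
  · obtain ⟨t₀, ht₀⟩ := hex
    refine (Set.countable_range fun k : ℤ => t₀ + k * L).mono fun t ht => ?_
    obtain ⟨k, hk⟩ := h.inj t₀ t (ht₀.trans (Eq.symm ht))
    exact ⟨k, hk.symm⟩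
  · exact Set.countable_empty.mono fun t ht => hex ⟨t, ht⟩

theorem exists_farthest (h : IsClosedSolution f c u κ L) : ∃ a, ∀ t, ‖c t‖ ≤ ‖c a‖ := by
  have hc := h.continuous
  obtain ⟨a, -, ha⟩ := isCompact_Icc.exists_isMaxOn (Set.nonempty_Icc.2 h.pos.le)
    (f := fun t => ‖c t‖) (by fun_prop)
  refine ⟨a, fun t => ?_⟩
  obtain ⟨s, hs, hst⟩ := h.periodic.exists_mem_Ico₀ h.pos t
  rw [hst]
  exact ha (Set.Ico_subset_Icc_self hs)

/-- If the moving path is constant, then the curve is a circle about the origin, and its base point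
is a fixed point of the flow. -/
theorem netWinding_of_constant (hf : ContDiffOn ℝ ∞ f (Set.Ioi 0))
    (h : IsClosedSolution f c u κ L) (hconst : ∀ t, movingPath c u t = movingPath c u 0) :
    (IsPeriodic f (movingPath c u 0) ∧ period f (movingPath c u 0) = 0) ∧
      netWinding f (movingPath c u 0) = 0 ∧ ZeroInExterior f (movingPath c u 0) := by
  set p := movingPath c u 0 with hp
  have hflow : ∀ t, flow f t p = p := fun t => (h.flow_movingPath hf t).trans (hconst t)
  have hper : period f p = 0 := by
    have : {t : ℝ | 0 < t ∧ flow f t p = p} = Set.Ioi 0 := by ext t; simp [hflow]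
    rw [period, this, csInf_Ioi]
  have hp0 : p ≠ 0 := by
    obtain ⟨t, ht⟩ := h.isFlowLine_movingPath.dense.nonempty
    rw [← hconst t]; exact ht
  refine ⟨⟨⟨1, one_pos, hflow 1⟩, hper⟩, by rw [netWinding, hper]; simp, ?_⟩
  refine not_isBounded_component_of_ray (neg_ne_zero.2 hp0) ?_
  rintro s hs ⟨t, ht⟩
  simp only [hflow] at ht
  have h1 : ((1 + s : ℝ) : ℂ) * p = 0 := by push_cast; linear_combination ht
  rcases mul_eq_zero.1 h1 with h2 | h2
  · have : (1 + s : ℝ) = 0 := by exact_mod_cast h2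
    linarith
  · exact hp0 h2

theorem isSimpleLoop (h : IsClosedSolution f c u κ L) {θ : ℝ → ℝ}
    (hθ : ∀ t, HasDerivAt θ (κ t) t) (hu : ∀ t, u t = Complex.exp (Complex.I * (θ t : ℂ))) :
    IsSimpleLoop c θ L where
  pos := h.pos
  continuous_angle := continuous_iff_continuousAt.2 fun t => (hθ t).continuousAt
  hasDerivAt t := hu t ▸ h.hasDerivAt t
  periodic := h.periodic
  inj := h.inj

/-- Seen from a farthest point, the rotation number of the curve is the sign of that point of the
orbit. -/
theorem rotation_eq_sign (h : IsClosedSolution f c u κ L) (hmax : ∀ t, ‖c t‖ ≤ ‖c 0‖)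
    {σ : ℤ} (hσ : σ = 1 ∨ σ = -1) (h0 : movingPath c u 0 = ((σ * ‖c 0‖ : ℝ) : ℂ)) {θ : ℝ → ℝ}
    (hθ : ∀ t, HasDerivAt θ (κ t) t) (hu : ∀ t, u t = Complex.exp (Complex.I * (θ t : ℂ))) :
    ∀ s, θ (s + L) = θ s + 2 * Real.pi * σ := by
  obtain ⟨β, hβ, -⟩ := h.exists_rotation h.movingPath_periodic hθ hu
  obtain ⟨k, hk⟩ := exp_I_mul_eq_iff.1 ((hu (0 + L)).symm.trans
    ((h.tangent_periodic 0).trans (hu 0)))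
  have hβk : β = 2 * Real.pi * k := by linarith [hβ 0]
  have hσ2 : (σ : ℝ) * σ = 1 := by rcases hσ with rfl | rfl <;> norm_num
  have key : k = σ := by
    refine (h.isSimpleLoop hθ hu).rotation_eq (fun s => by rw [hβ, hβk]) hσ fun t => ?_
    have e1 : Complex.exp (Complex.I * ((-θ 0 : ℝ) : ℂ)) = (starRingEnd ℂ) (u 0) := by
      rw [hu 0, ← Complex.exp_conj]; simp
    have e2 : (starRingEnd ℂ) (u 0) * c 0 = -Complex.I * ((σ * ‖c 0‖ : ℝ) : ℂ) := by
      rw [← h0, h.eq_conj_movingPath 0, h0, Complex.conj_ofReal]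
      linear_combination (-Complex.I * ((σ * ‖c 0‖ : ℝ) : ℂ)) * h.tangent_mul_conj 0
    have e3 : |((starRingEnd ℂ) (u 0) * c t).im| ≤ ‖c 0‖ := by
      refine (Complex.abs_im_le_norm _).trans ?_
      rw [norm_mul, Complex.norm_conj, h.norm_tangent, one_mul]
      exact hmax t
    rw [e1, mul_sub, e2, Complex.sub_im]
    have e4 : (-Complex.I * ((σ * ‖c 0‖ : ℝ) : ℂ)).im = -(σ * ‖c 0‖) := by simp
    rw [e4, sub_neg_eq_add, mul_add, ← mul_assoc, hσ2, one_mul]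
    have e5 := abs_le.1 e3
    rcases hσ with rfl | rfl
    · push_cast; linarith [e5.1]
    · push_cast; linarith [e5.2]
  intro s
  rw [hβ, hβk, key]

/-- If the minimal period of the orbit is shorter than the curve, then the argument of the orbit
does not grow over a period: the arguments of the curve and of its tangent grow equally by
`IsSimpleLoop.arg_add_of_symmetric`. -/
theorem isWinding_zero (h : IsClosedSolution f c u κ L) {T : ℝ} (hT0 : 0 < T) (hTL : T < L)
    (hT : Function.Periodic (movingPath c u) T) : IsWinding (movingPath c u) T 0 0 := by
  obtain ⟨θ, hθ, hu⟩ := h.exists_tangentAngle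
  obtain ⟨α, hα, hcα⟩ := h.exists_rotation hT hθ hu
  have hloop := h.isSimpleLoop hθ hu
  have hc0 := hloop.ne_zero_of_symmetric hT0 hTL hcα
  obtain ⟨χ, hχ⟩ := exists_isArgOn (g := c) convex_univ isOpen_univ Set.univ_nonempty
    h.continuous.continuousOn (fun t _ => hc0 t)
  have hχT := hloop.arg_add_of_symmetric hT0 hTL hα hcα hχ
  refine ⟨fun t h0 => hc0 t ((h.movingPath_eq_zero_iff t).1 h0),
    fun t => -χ t + θ t - Real.pi / 2, ⟨?_, fun t _ => ?_⟩, fun t => ?_⟩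
  · exact (hχ.1.neg.add hloop.continuous_angle.continuousOn).sub continuousOn_const
  · have e1 : (starRingEnd ℂ) (c t) = (‖c t‖ : ℂ) * Complex.exp (-(Complex.I * (χ t : ℂ))) := by
      have := congrArg (starRingEnd ℂ) (hχ.2 t trivial)
      rw [this, map_mul, Complex.conj_ofReal, ← Complex.exp_conj]
      congr 2
      simp
    have e2 : Complex.exp (-(Real.pi / 2 * Complex.I)) = -Complex.I := by
      rw [← neg_mul, ← neg_div]
      exact Complex.exp_neg_pi_div_two_mul_I
    simp only [sub_zero]
    rw [h.norm_movingPath, movingPath, e1, hu t]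
    have e3 : Complex.exp (Complex.I * ((-χ t + θ t - Real.pi / 2 : ℝ) : ℂ)) =
        Complex.exp (-(Complex.I * (χ t : ℂ))) * Complex.exp (Complex.I * (θ t : ℂ)) *
          Complex.exp (-(Real.pi / 2 * Complex.I)) := by
      rw [← Complex.exp_add, ← Complex.exp_add]; congr 1; push_cast; ring
    rw [e3, e2]
    ring
  · simp only [hχT, hα]; push_cast; ring

/-- If the moving path is not constant, then the curve consists of `n ≥ 1` congruent arcs, each of
which contributes the net winding to the rotation number. -/
theorem netWinding_of_not_constant (hf : ContDiffOn ℝ ∞ f (Set.Ioi 0))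
    (h : IsClosedSolution f c u κ L) (hne : ¬ ∀ t, movingPath c u t = movingPath c u 0) :
    (IsPeriodic f (movingPath c u 0) ∧
      IntervalIntegrable (fun t => f ‖flow f t (movingPath c u 0)‖) MeasureTheory.volume 0
        (period f (movingPath c u 0))) ∧
      ∃ n : ℕ, 0 < n ∧ netWinding f (movingPath c u 0) = 1 / (n : ℝ) ∧
        (¬ ZeroInExterior f (movingPath c u 0) → n = 1) := by
  set p := movingPath c u 0 with hp
  obtain ⟨T, hT0, hT, hmin⟩ := h.exists_minimal_period hf h.pos h.movingPath_periodic hne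
  have hflow : ∀ t, flow f t p = movingPath c u t := h.flow_movingPath hf
  have hflow' : (fun t => flow f t p) = movingPath c u := funext hflow
  have hpT : flow f T p = p := by rw [hflow, ← zero_add T, hT 0]
  have hperiod : period f p = T := by
    refine IsLeast.csInf_eq ⟨⟨hT0, hpT⟩, ?_⟩
    rintro t ⟨ht0, ht⟩
    obtain ⟨k, hk⟩ := hmin 0 t ((hflow t).symm.trans ht).symm
    rw [zero_add] at hk
    have h3 : (0 : ℝ) < k := by
      by_contra hcon
      nlinarith [not_lt.1 hcon]
    have h4 : (1 : ℝ) ≤ k := by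
      have : (0 : ℤ) < k := by exact_mod_cast h3
      exact_mod_cast (show (1 : ℤ) ≤ k by omega)
    nlinarith
  obtain ⟨θ, hθ, hu⟩ := h.exists_tangentAngle
  obtain ⟨α, hα, hcα⟩ := h.exists_rotation hT hθ hu
  -- the curvature is the integrand, except at the times when the curve meets the origin
  have hκ : Continuous κ := h.contDiff_curvature.continuous
  have hae : ∀ᵐ t : ℝ, κ t = f ‖flow f t p‖ := by
    filter_upwards [h.countable_zeros.ae_notMem MeasureTheory.volume] with t ht
    rw [hflow, h.norm_movingPath]
    exact h.curvature_eq t ht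
  have hint : IntervalIntegrable (fun t => f ‖flow f t p‖) MeasureTheory.volume 0
      (period f p) := by
    rw [hperiod]
    exact (hκ.intervalIntegrable 0 T).congr_ae (MeasureTheory.ae_restrict_of_ae hae)
  have hval : ∫ t in (0 : ℝ)..period f p, f ‖flow f t p‖ = α := by
    rw [hperiod, ← intervalIntegral.integral_congr_ae (hae.mono fun t ht _ => ht),
      intervalIntegral.integral_eq_sub_of_hasDerivAt (fun t _ => hθ t)
        (hκ.intervalIntegrable 0 T)]
    have := hα 0
    rw [zero_add] at this
    linarith
  refine ⟨⟨⟨T, hT0, hpT⟩, hint⟩, ?_⟩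
  -- the curve consists of `m` arcs, each described by one turn of the orbit
  obtain ⟨m, hm⟩ := hmin 0 L (by rw [← h.movingPath_periodic 0, zero_add])
  rw [zero_add] at hm
  have hm0 : 0 < m := by
    have : (0 : ℝ) < m := by
      by_contra hcon
      nlinarith [not_lt.1 hcon, h.pos]
    exact_mod_cast this
  lift m to ℕ using hm0.le
  rw [Int.cast_natCast] at hm
  have hm0' : 0 < m := by exact_mod_cast hm0
  -- the orbit, started at a point farthest from the origin
  obtain ⟨a, ha⟩ := h.exists_farthest
  have hs := h.shift a
  set Z : ℝ → ℂ := movingPath (fun t => c (t + a)) (fun t => u (t + a)) with hZ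
  have hZt : ∀ t, Z t = movingPath c u (t + a) := fun t => rfl
  have hZT : Function.Periodic Z T := hT.add_const a
  have hov : IsOval Z T := by
    refine hs.isOval hf (fun t => by simpa using ha (t + a)) hT0 hZT fun s t hst => ?_
    obtain ⟨k, hk⟩ := hmin _ _ hst
    exact ⟨k, by linarith⟩
  have hreal : Z 0 = ((Z 0).re : ℂ) := Complex.ext rfl (by simp [hov.im_zero])
  have hnorm : |(Z 0).re| = ‖Z 0‖ := by rw [hreal, Complex.norm_real, Complex.ofReal_re]; rfl
  obtain ⟨σ, hσ, hσpos⟩ : ∃ σ : ℤ, (σ = 1 ∨ σ = -1) ∧ (σ : ℝ) * (Z 0).re = ‖Z 0‖ := by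
    rw [← hnorm]
    rcases le_total 0 (Z 0).re with h0 | h0
    · exact ⟨1, Or.inl rfl, by rw [abs_of_nonneg h0]; simp⟩
    · exact ⟨-1, Or.inr rfl, by rw [abs_of_nonpos h0]; simp⟩
  have hσ2 : (σ : ℝ) * σ = 1 := by rcases hσ with rfl | rfl <;> norm_num
  have hlt := hov.norm_half_lt
  have hZ0 : 0 < ‖Z 0‖ := (norm_nonneg _).trans_lt hlt
  have hhalf : |(σ : ℝ) * (Z (T / 2)).re| < ‖Z 0‖ := by
    have h1 : |(σ : ℝ)| = 1 := by rcases hσ with rfl | rfl <;> simp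
    rw [abs_mul, h1, one_mul]
    exact (Complex.abs_re_le_norm _).trans_lt hlt
  have hrot : (m : ℝ) * α = 2 * Real.pi * σ := by
    have h1 := hs.rotation_eq_sign (fun t => by simpa using ha (t + a)) hσ
      (show Z 0 = _ by
        rw [← hs.norm_movingPath]
        change Z 0 = ((σ * ‖Z 0‖ : ℝ) : ℂ)
        rw [← hσpos, ← mul_assoc, hσ2, one_mul]
        exact hreal)
      (θ := fun t => θ (t + a)) (fun t => (hθ (t + a)).comp_add_const t a) (fun t => hu _) 0
    have h2 : ∀ k : ℕ, θ (0 + a + k * T) = θ (0 + a) + k * α := by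
      intro k
      induction k with
      | zero => simp
      | succ k ih =>
        rw [show 0 + a + ((k + 1 : ℕ) : ℝ) * T = 0 + a + k * T + T by push_cast; ring, hα, ih]
        push_cast; ring
    have h3 := h2 m
    rw [← hm] at h3
    rw [show (0 : ℝ) + L + a = 0 + a + L by ring, h3] at h1
    linarith
  have hcc : IsCounterclockwise f p ↔ σ = 1 := by
    have hw : ∀ w, HasWindingNumber (fun t => flow f t p) (period f p) w 1 ↔
        IsWinding Z T w 1 := by
      intro w
      rw [← hasWindingNumber_shift_iff hov.continuous hT0 hZT (-a) w 1, hperiod, hflow']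
      have : (fun t => Z (t + -a)) = movingPath c u := by
        funext t; rw [hZt]; congr 1; ring
      rw [this]
    constructor
    · rintro ⟨w, hw1⟩
      rcases hσ with e | e
      · exact e
      · rw [hw] at hw1
        refine absurd hw1 (hov.not_isWinding_one ?_ w)
        rw [e] at hσpos
        push_cast at hσpos
        linarith
    · intro e
      have h1 := hov.isWinding_of_between hσ (w := ((Z 0).re + (Z (T / 2)).re) / 2)
        (by linarith [le_abs_self ((σ : ℝ) * (Z (T / 2)).re)])
        (by linarith [le_abs_self ((σ : ℝ) * (Z (T / 2)).re)])
      rw [e] at h1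
      exact ⟨_, (hw _).2 h1⟩
  have hm1 : (m : ℝ) ≠ 0 := by exact_mod_cast hm0'.ne'
  refine ⟨m, hm0', ?_, fun hext => ?_⟩
  · have hα' : α = 2 * Real.pi * σ / m := by field_simp; linarith
    have hpi := Real.pi_pos
    rw [netWinding, hval, hα']
    rcases hσ with e | e
    · rw [if_pos (hcc.2 e), e]; push_cast; field_simp
    · rw [if_neg (fun hcon => by have := hcc.1 hcon; omega), e]; push_cast; field_simp
  · by_contra hne1
    have hTL : T < L := by
      have : (2 : ℝ) ≤ m := by exact_mod_cast (show 2 ≤ m by omega)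
      nlinarith
    have hwind := hs.isWinding_zero hT0 hTL hZT
    have horbit : orbit f p = Set.range Z := by
      ext z
      constructor
      · rintro ⟨t, rfl⟩
        exact ⟨t - a, by rw [hZt, sub_add_cancel]; exact (hflow t).symm⟩
      · rintro ⟨t, rfl⟩
        exact ⟨t + a, hflow _⟩
    have hx0 : (0 : ℝ) < σ * (Z 0).re := hσpos ▸ hZ0
    -- the orbit meets the real axis on both sides of the origin, or at it, or on one side only
    rcases lt_trichotomy ((σ : ℝ) * (Z (T / 2)).re) 0 with hx | hx | hx
    · have h1 := hov.isWinding_of_between hσ (w := 0) (by simpa using hx0) (by simpa using hx)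
      rw [Complex.ofReal_zero] at h1
      have := IsWinding.unique hov.continuous hZT h1 hwind
      omega
    · have hσ0 : (σ : ℝ) ≠ 0 := by rintro e; rw [e] at hσ2; norm_num at hσ2
      have hre := (mul_eq_zero.1 hx).resolve_left hσ0
      exact hwind.1 (T / 2) (Complex.ext hre hov.im_half)
    · refine hext ?_
      rw [ZeroInExterior, horbit]
      exact hov.not_isBounded_component hσ2 hx0 hx

end IsClosedSolution

/-! ### A Jordan solution closes up periodically -/

/-- If a curve with unit speed traces the same points at the times `t` and `h(t)`, with `h`
increasing, then `h` is a translation. -/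
theorem sub_eq_sub_of_unit_speed {c : ℝ → ℂ} {h : ℝ → ℝ} {a b : ℝ}
    (hc : ∀ t ∈ Set.Ioo a b, ∃ u, HasDerivAt c u t ∧ ‖u‖ = 1)
    (hch : ∀ t ∈ Set.Ioo a b, ∃ u, HasDerivAt c u (h t) ∧ ‖u‖ = 1)
    (hmono : StrictMonoOn h (Set.Ioo a b)) (hcont : ContinuousOn h (Set.Ioo a b))
    (heq : ∀ t ∈ Set.Ioo a b, c (h t) = c t) {s t : ℝ} (hs : s ∈ Set.Ioo a b)
    (ht : t ∈ Set.Ioo a b) : h t - t = h s - s := by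
  have hspeed : ∀ {x : ℝ} {u : ℂ}, HasDerivAt c u x → ‖u‖ = 1 →
      Filter.Tendsto (fun y => ‖c y - c x‖ / |y - x|) (nhdsWithin x {x}ᶜ) (nhds 1) := by
    intro x u hu hu1
    have := (hasDerivAt_iff_tendsto_slope.1 hu).norm
    rw [hu1] at this
    refine this.congr fun y => ?_
    rw [slope_def_module, norm_smul, norm_inv, Real.norm_eq_abs, div_eq_inv_mul]
  have hder : ∀ x ∈ Set.Ioo a b, HasDerivAt h 1 x := by
    intro x hx
    rw [hasDerivAt_iff_tendsto_slope]
    obtain ⟨u, hu, hu1⟩ := hc x hx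
    obtain ⟨v, hv, hv1⟩ := hch x hx
    have hmem : ∀ᶠ y in nhdsWithin x {x}ᶜ, y ∈ Set.Ioo a b :=
      nhdsWithin_le_nhds (isOpen_Ioo.mem_nhds hx)
    have hh : Filter.Tendsto h (nhdsWithin x {x}ᶜ) (nhdsWithin (h x) {h x}ᶜ) := by
      refine tendsto_nhdsWithin_iff.2 ⟨?_, ?_⟩
      · exact (hcont.continuousAt (isOpen_Ioo.mem_nhds hx)).tendsto.mono_left nhdsWithin_le_nhds
      · filter_upwards [hmem, self_mem_nhdsWithin] with y hy hyx hcon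
        exact hyx (hmono.injOn hy hx hcon)
    have h1 := hspeed hu hu1
    have h2 := (hspeed hv hv1).comp hh
    have h3 := h1.div h2 one_ne_zero
    rw [div_one] at h3
    refine h3.congr' ?_
    filter_upwards [hmem, self_mem_nhdsWithin, h1.eventually_ne one_ne_zero] with y hy hyx hne
    have hyx' : y ≠ x := hyx
    have hN : ‖c y - c x‖ ≠ 0 := fun h0 => hne (by rw [h0, zero_div])
    have habs : |h y - h x| / |y - x| = slope h x y := by
      rw [slope_def_field, ← abs_div, abs_of_pos]
      rcases lt_or_gt_of_ne hyx' with hlt | hgt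
      · exact div_pos_of_neg_of_neg (sub_neg.2 (hmono hy hx hlt)) (sub_neg.2 hlt)
      · exact div_pos (sub_pos.2 (hmono hx hy hgt)) (sub_pos.2 hgt)
    simp only [Function.comp_apply, Pi.div_apply]
    rw [heq y hy, heq x hx, ← habs]
    have h4 : |y - x| ≠ 0 := abs_ne_zero.2 (sub_ne_zero.2 hyx')
    have h5 : |h y - h x| ≠ 0 :=
      abs_ne_zero.2 (sub_ne_zero.2 fun e => hyx' (hmono.injOn hy hx e))
    field_simp
  have hd0 : ∀ x ∈ Set.Ioo a b, HasDerivAt (fun x => h x - x) 0 x := fun x hx =>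
    ((hder x hx).sub (hasDerivAt_id x)).congr_deriv (sub_self 1)
  exact isOpen_Ioo.is_const_of_deriv_eq_zero isPreconnected_Ioo
    (fun x hx => (hd0 x hx).differentiableAt.differentiableWithinAt) (fun x hx => (hd0 x hx).deriv)
    ht hs

namespace ArcPath

variable {c : ArcPath}

theorem contDiffAt (c : ArcPath) {t : ℝ} (ht : t ∈ c.dom) : ContDiffAt ℝ ∞ c.toFun t :=
  c.smooth.contDiffAt (c.isOpen_dom.mem_nhds ht)

theorem hasDerivAt (c : ArcPath) {t : ℝ} (ht : t ∈ c.dom) :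
    HasDerivAt c.toFun (deriv c.toFun t) t :=
  ((c.contDiffAt ht).differentiableAt (by simp)).hasDerivAt

/-- A curve with unit speed is locally injective. -/
theorem exists_injOn (c : ArcPath) {t : ℝ} (ht : t ∈ c.dom) :
    ∃ ε > 0, Set.Ioo (t - ε) (t + ε) ⊆ c.dom ∧ Set.InjOn c.toFun (Set.Ioo (t - ε) (t + ε)) := by
  have hs : HasStrictDerivAt c.toFun (deriv c.toFun t) t :=
    (c.contDiffAt ht).hasStrictDerivAt (by simp)
  have h1 := hs.isLittleO.def (show (0 : ℝ) < 1 / 2 by norm_num)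
  obtain ⟨ε₁, hε₁, hb⟩ := Metric.eventually_nhds_iff.1 h1
  obtain ⟨ε₂, hε₂, hb₂⟩ := Metric.isOpen_iff.1 c.isOpen_dom t ht
  refine ⟨min ε₁ ε₂, lt_min hε₁ hε₂, ?_, ?_⟩
  · rw [← Real.ball_eq_Ioo]
    exact (Metric.ball_subset_ball (min_le_right _ _)).trans hb₂
  · rw [← Real.ball_eq_Ioo]
    intro x hx y hy hxy
    have h2 := hb (y := (x, y)) (by
      rw [Prod.dist_eq]
      exact max_lt (lt_of_lt_of_le hx (min_le_left _ _)) (lt_of_lt_of_le hy (min_le_left _ _)))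
    simp only [hxy, sub_self, zero_sub, norm_neg, ContinuousLinearMap.toSpanSingleton_apply,
      norm_smul, c.unit_speed t ht, mul_one] at h2
    have h3 : ‖x - y‖ = 0 := by linarith [norm_nonneg (x - y)]
    exact sub_eq_zero.1 (norm_eq_zero.1 h3)

theorem mem_trace (c : ArcPath) {t : ℝ} (ht : t ∈ c.dom) : c.toFun t ∈ c.trace := ⟨t, ht, rfl⟩

/-- A simple closed curve is parametrized through a strictly increasing angle: the map to the
circle is lifted to the line, and the lift is locally injective, hence without local extrema. -/
theorem exists_angle (hj : c.IsSimpleClosed) :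
    ∃ g : ℝ → ℝ, ContinuousOn g c.dom ∧ StrictMonoOn g c.dom ∧
      (∀ s ∈ c.dom, ∀ t ∈ c.dom, c.toFun s = c.toFun t ↔ ∃ k : ℤ, g s = g t + 2 * Real.pi * k) ∧
      ∀ x, ∃ t ∈ c.dom, ∃ k : ℤ, g t = x + 2 * Real.pi * k := by
  classical
  obtain ⟨e⟩ := hj
  have hconv : Convex ℝ c.dom := c.ordConnected_dom.convex
  set E : ℝ → ℂ := fun t => if ht : t ∈ c.dom then
    ((e ⟨c.toFun t, c.mem_trace ht⟩ : Circle) : ℂ) else 1 with hE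
  have hEt : ∀ t (ht : t ∈ c.dom), E t = ((e ⟨c.toFun t, c.mem_trace ht⟩ : Circle) : ℂ) :=
    fun t ht => dif_pos ht
  have hEnorm : ∀ t ∈ c.dom, ‖E t‖ = 1 := fun t ht => by rw [hEt t ht, Circle.norm_coe]
  have hEc : ContinuousOn E c.dom := by
    rw [continuousOn_iff_continuous_domRestrict]
    have hcc : Continuous fun t : c.dom => c.toFun t := c.smooth.continuousOn.domRestrict
    have : c.dom.domRestrict E = fun t : c.dom =>
        ((e ⟨c.toFun t, c.mem_trace t.2⟩ : Circle) : ℂ) := by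
      funext t; exact hEt t t.2
    rw [this]
    exact continuous_subtype_val.comp (e.continuous.comp (hcc.subtype_mk _))
  obtain ⟨ψ, hψ⟩ := exists_isArgOn hconv c.isOpen_dom ⟨0, c.zero_mem⟩ hEc
    (fun t ht => norm_ne_zero_iff.1 (by rw [hEnorm t ht]; exact one_ne_zero))
  have hEψ : ∀ t ∈ c.dom, E t = Complex.exp (Complex.I * (ψ t : ℂ)) := fun t ht => by
    have := hψ.2 t ht
    rwa [hEnorm t ht, Complex.ofReal_one, one_mul] at this
  have hiff : ∀ s ∈ c.dom, ∀ t ∈ c.dom,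
      c.toFun s = c.toFun t ↔ ∃ k : ℤ, ψ s = ψ t + 2 * Real.pi * k := by
    intro s hs t ht
    rw [← exp_I_mul_eq_iff, ← hEψ s hs, ← hEψ t ht, hEt s hs, hEt t ht, Circle.coe_inj,
      e.injective.eq_iff, Subtype.mk_eq_mk]
  have hsurj : ∀ x, ∃ t ∈ c.dom, ∃ k : ℤ, ψ t = x + 2 * Real.pi * k := by
    intro x
    obtain ⟨t, ht, htx⟩ := (e.symm (Circle.exp x)).2
    refine ⟨t, ht, exp_I_mul_eq_iff.1 ?_⟩
    rw [← hEψ t ht, hEt t ht]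
    have : (⟨c.toFun t, c.mem_trace ht⟩ : c.trace) = e.symm (Circle.exp x) := Subtype.ext htx
    rw [this, e.apply_symm_apply, Circle.coe_exp, mul_comm]
  have hinj : Set.InjOn ψ c.dom := by
    have key : ∀ a ∈ c.dom, ∀ b ∈ c.dom, a < b → ψ a ≠ ψ b := by
      intro a ha b hb hab hψab
      have hsub : Set.Icc a b ⊆ c.dom := c.ordConnected_dom.out ha hb
      obtain ⟨x, hx, hext⟩ := exists_isLocalExtr_Ioo hab (hψ.1.mono hsub) hψab
      obtain ⟨ε, hε, hεs, hεi⟩ := c.exists_injOn (hsub (Set.Ioo_subset_Icc_self hx))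
      have hi : Set.InjOn ψ (Set.Ioo (x - ε) (x + ε)) := fun s hs t ht hst =>
        hεi hs ht ((hiff s (hεs hs) t (hεs ht)).2 ⟨0, by simpa using hst⟩)
      have hmem : x ∈ Set.Ioo (x - ε) (x + ε) := ⟨by linarith, by linarith⟩
      have hnear : ∀ᶠ y in nhds x, y ∈ Set.Ioo (x - ε) (x + ε) := isOpen_Ioo.mem_nhds hmem
      have hR : ∀ {P : ℝ → Prop}, (∀ᶠ y in nhds x, P y) →
          ∃ y ∈ Set.Ioo (x - ε) (x + ε), x < y ∧ P y := by
        intro P hP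
        obtain ⟨y, ⟨h1, h2⟩, h3⟩ := (((hP.and hnear).filter_mono
          (nhdsWithin_le_nhds (s := Set.Ioi x))).and self_mem_nhdsWithin).exists
        exact ⟨y, h2, h3, h1⟩
      have hL : ∀ {P : ℝ → Prop}, (∀ᶠ y in nhds x, P y) →
          ∃ y ∈ Set.Ioo (x - ε) (x + ε), y < x ∧ P y := by
        intro P hP
        obtain ⟨y, ⟨h1, h2⟩, h3⟩ := (((hP.and hnear).filter_mono
          (nhdsWithin_le_nhds (s := Set.Iio x))).and self_mem_nhdsWithin).exists
        exact ⟨y, h2, h3, h1⟩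
      rcases ContinuousOn.strictMonoOn_of_injOn_Ioo (by linarith) (hψ.1.mono hεs) hi with hm | hm
      · rcases hext with hmin | hmax
        · obtain ⟨y, hy, hyx, hle⟩ := hL hmin
          exact (hm hy hmem hyx).not_ge hle
        · obtain ⟨y, hy, hyx, hle⟩ := hR hmax
          exact (hm hmem hy hyx).not_ge hle
      · rcases hext with hmin | hmax
        · obtain ⟨y, hy, hyx, hle⟩ := hR hmin
          exact (hm hmem hy hyx).not_ge hle
        · obtain ⟨y, hy, hyx, hle⟩ := hL hmax
          exact (hm hy hmem hyx).not_ge hle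
    intro a ha b hb hab
    rcases lt_trichotomy a b with h | h | h
    · exact absurd hab (key a ha b hb h)
    · exact h
    · exact absurd hab.symm (key b hb a ha h)
  have : Inhabited c.dom := ⟨⟨0, c.zero_mem⟩⟩
  have := c.ordConnected_dom
  rcases Continuous.strictMono_of_inj hψ.1.domRestrict hinj.injective with hm | hm
  · exact ⟨ψ, hψ.1, strictMono_domRestrict.1 hm, hiff, hsurj⟩
  · refine ⟨fun t => -ψ t, hψ.1.neg, fun s hs t ht hst => neg_lt_neg
      (hm (show (⟨s, hs⟩ : c.dom) < ⟨t, ht⟩ from hst)), fun s hs t ht => ?_, fun x => ?_⟩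
    · rw [hiff s hs t ht]
      constructor
      · rintro ⟨k, hk⟩; exact ⟨-k, by push_cast; linarith⟩
      · rintro ⟨k, hk⟩; exact ⟨-k, by push_cast; linarith⟩
    · obtain ⟨t, ht, k, hk⟩ := hsurj (-x)
      exact ⟨t, ht, -k, by push_cast; linarith⟩

theorem exists_gt_mem (c : ArcPath) {t : ℝ} (ht : t ∈ c.dom) : ∃ s ∈ c.dom, t < s := by
  obtain ⟨ε, hε, hsub, -⟩ := c.exists_injOn ht
  exact ⟨t + ε / 2, hsub ⟨by linarith, by linarith⟩, by linarith⟩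

theorem exists_lt_mem (c : ArcPath) {t : ℝ} (ht : t ∈ c.dom) : ∃ s ∈ c.dom, s < t := by
  obtain ⟨ε, hε, hsub, -⟩ := c.exists_injOn ht
  exact ⟨t - ε / 2, hsub ⟨by linarith, by linarith⟩, by linarith⟩

/-- A simple closed curve runs through a full turn around the time `0`, and repeats itself near the
ends of it. Here compactness of the circle enters: an increasing angle on an open interval takes
all values modulo `2π` only if its values extend over more than one turn. -/
theorem exists_turn (hj : c.IsSimpleClosed) :
    ∃ t₁ t₂, t₁ ≤ 0 ∧ 0 < t₂ ∧ Set.Icc t₁ t₂ ⊆ c.dom ∧ Set.InjOn c.toFun (Set.Ico t₁ t₂) ∧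
      ∀ᶠ t in nhds t₁, c.toFun (t + (t₂ - t₁)) = c.toFun t := by
  obtain ⟨g, hgc, hgm, hiff, hsurj⟩ := exists_angle hj
  have hpi := Real.pi_pos
  have hA : (g '' c.dom).OrdConnected :=
    (c.ordConnected_dom.isPreconnected.image g hgc).ordConnected
  have hivt : ∀ s ∈ c.dom, ∀ t ∈ c.dom, ∀ y, g s ≤ y → y ≤ g t → ∃ x ∈ c.dom, g x = y :=
    fun s hs t ht y h1 h2 =>
      hA.out (Set.mem_image_of_mem g hs) (Set.mem_image_of_mem g ht) ⟨h1, h2⟩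
  have hlt : ∀ s ∈ c.dom, ∀ t ∈ c.dom, (g s < g t ↔ s < t) := fun s hs t ht => hgm.lt_iff_lt hs ht
  obtain ⟨a, ha, b, hb, hab⟩ : ∃ a ∈ c.dom, ∃ b ∈ c.dom, g b = g a + 2 * Real.pi := by
    by_contra! hno
    have hno' : ∀ a ∈ c.dom, ∀ b ∈ c.dom, g b ≤ g a + 2 * Real.pi := by
      intro a ha b hb
      by_contra! hlt
      obtain ⟨x, hx, hgx⟩ := hivt a ha b hb (g a + 2 * Real.pi) (by linarith) hlt.le
      exact hno a ha x hx hgx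
    have hbdd : BddAbove (g '' c.dom) :=
      ⟨g 0 + 2 * Real.pi, by rintro _ ⟨b, hb, rfl⟩; exact hno' 0 c.zero_mem b hb⟩
    have hne : (g '' c.dom).Nonempty := ⟨_, Set.mem_image_of_mem g c.zero_mem⟩
    have hsup : ∀ t ∈ c.dom, g t < sSup (g '' c.dom) := by
      intro t ht
      obtain ⟨s, hs, hts⟩ := c.exists_gt_mem ht
      exact (hgm ht hs hts).trans_le (le_csSup hbdd (Set.mem_image_of_mem g hs))
    -- the supremum is not attained, but it is a value modulo `2π`
    obtain ⟨t, ht, k, hk⟩ := hsurj (sSup (g '' c.dom))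
    have hk1 : (k : ℝ) ≤ -1 := by
      have h1 : (k : ℝ) < 0 := by
        by_contra hcon
        have := hsup t ht
        nlinarith [not_lt.1 hcon]
      have h2 : k < 0 := by exact_mod_cast h1
      exact_mod_cast (show k ≤ -1 by omega)
    obtain ⟨s, hs, hst⟩ := c.exists_lt_mem ht
    have h3 : g s + 2 * Real.pi < sSup (g '' c.dom) := by
      have := hgm hs ht hst
      nlinarith
    obtain ⟨_, ⟨x, hx, rfl⟩, hx'⟩ := exists_lt_of_lt_csSup hne h3
    exact absurd (hno' s hs x hx) (not_le.2 hx')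
  obtain ⟨t₁, h1, t₂, h2, h12, h10, h02⟩ : ∃ t₁ ∈ c.dom, ∃ t₂ ∈ c.dom,
      g t₂ = g t₁ + 2 * Real.pi ∧ t₁ ≤ 0 ∧ 0 < t₂ := by
    by_cases hex : ∃ t ∈ c.dom, g t = g 0 + 2 * Real.pi
    · obtain ⟨t, ht, hgt⟩ := hex
      exact ⟨0, c.zero_mem, t, ht, hgt, le_rfl,
        (hlt 0 c.zero_mem t ht).1 (by linarith)⟩
    · have hbd : ∀ t ∈ c.dom, g t < g 0 + 2 * Real.pi := by
        intro t ht
        by_contra! hcon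
        exact hex (hivt 0 c.zero_mem t ht _ (by linarith) hcon)
      obtain ⟨s, hs, hs0⟩ := c.exists_gt_mem c.zero_mem
      obtain ⟨t₂, h2, hs2, hb2⟩ : ∃ t₂ ∈ c.dom, g s ≤ g t₂ ∧ g b ≤ g t₂ := by
        rcases le_total (g s) (g b) with h | h
        · exact ⟨b, hb, h, le_rfl⟩
        · exact ⟨s, hs, le_rfl, h⟩
      have := hbd t₂ h2
      obtain ⟨t₁, h1, h12⟩ := hivt a ha 0 c.zero_mem (g t₂ - 2 * Real.pi) (by linarith)
        (by linarith)
      refine ⟨t₁, h1, t₂, h2, by linarith, ?_, ?_⟩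
      · exact ((hlt t₁ h1 0 c.zero_mem).1 (by linarith)).le
      · exact (hlt 0 c.zero_mem t₂ h2).1
          ((hgm c.zero_mem hs hs0).trans_le hs2)
  have hsub : Set.Icc t₁ t₂ ⊆ c.dom := c.ordConnected_dom.out h1 h2
  refine ⟨t₁, t₂, h10, h02, hsub, ?_, ?_⟩
  · intro s hs t ht hst
    have hs' := hsub (Set.Ico_subset_Icc_self hs)
    have ht' := hsub (Set.Ico_subset_Icc_self ht)
    obtain ⟨k, hk⟩ := (hiff s hs' t ht').1 hst
    have l1 : g t₁ ≤ g s := hgm.monotoneOn h1 hs' hs.1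
    have l2 : g t₁ ≤ g t := hgm.monotoneOn h1 ht' ht.1
    have l3 : g s < g t₂ := hgm hs' h2 hs.2
    have l4 : g t < g t₂ := hgm ht' h2 ht.2
    have hk1 : |(k : ℝ)| < 1 := by
      rw [abs_lt]
      constructor <;> nlinarith
    have hk0 : k = 0 := by
      have : |k| < 1 := by exact_mod_cast hk1
      exact Int.abs_lt_one_iff.1 this
    exact hgm.injOn hs' ht' (by rw [hk, hk0]; simp)
  · obtain ⟨p, hp, hp1⟩ := c.exists_lt_mem h1
    obtain ⟨q, hq, hq2⟩ := c.exists_gt_mem h2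
    obtain ⟨r, hr, hgr⟩ := hivt t₁ h1 q hq (g q - 2 * Real.pi)
      (by linarith [hgm h2 hq hq2]) (by linarith)
    have hr1 : t₁ < r := (hlt t₁ h1 r hr).1 (by linarith [hgm h2 hq hq2])
    have hpr : Set.Ioo p r ⊆ c.dom := fun x hx =>
      c.ordConnected_dom.out hp hr (Set.Ioo_subset_Icc_self hx)
    -- the time one turn later
    have hex : ∀ x, ∃ y, x ∈ Set.Ioo p r → y ∈ c.dom ∧ g y = g x + 2 * Real.pi := by
      intro x
      by_cases hx : x ∈ Set.Ioo p r
      · obtain ⟨y, hy, hgy⟩ := hivt x (hpr hx) q hq (g x + 2 * Real.pi) (by linarith)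
          (by linarith [hgm (hpr hx) hr hx.2])
        exact ⟨y, fun _ => ⟨hy, hgy⟩⟩
      · exact ⟨0, fun h => absurd h hx⟩
    choose h hh using hex
    have hm : StrictMonoOn h (Set.Ioo p r) := by
      intro x hx y hy hxy
      refine (hlt _ (hh x hx).1 _ (hh y hy).1).1 ?_
      rw [(hh x hx).2, (hh y hy).2]
      linarith [hgm (hpr hx) (hpr hy) hxy]
    have hhc : ContinuousOn h (Set.Ioo p r) := by
      intro x hx
      have hgx : ContinuousWithinAt (fun x => g x + 2 * Real.pi) (Set.Ioo p r) x :=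
        ((hgc.mono hpr) x hx).add continuousWithinAt_const
      refine tendsto_order.2 ⟨fun l hl => ?_, fun l hl => ?_⟩
      · obtain ⟨l', hl', hll', hlx⟩ : ∃ l' ∈ c.dom, l ≤ l' ∧ l' < h x := by
          obtain ⟨s, hs, hsx⟩ := c.exists_lt_mem (hh x hx).1
          rcases le_total l s with hls | hls
          · exact ⟨s, hs, hls, hsx⟩
          · exact ⟨l, c.ordConnected_dom.out hs (hh x hx).1 ⟨hls, hl.le⟩, le_rfl, hl⟩
        have := hgx.eventually_const_lt (u := g l') (by
          change g l' < g x + 2 * Real.pi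
          rw [← (hh x hx).2]; exact hgm hl' (hh x hx).1 hlx)
        filter_upwards [this, self_mem_nhdsWithin] with y hy hyI
        refine hll'.trans_lt ((hlt _ hl' _ (hh y hyI).1).1 ?_)
        rw [(hh y hyI).2]; exact hy
      · obtain ⟨l', hl', hll', hlx⟩ : ∃ l' ∈ c.dom, l' ≤ l ∧ h x < l' := by
          obtain ⟨s, hs, hsx⟩ := c.exists_gt_mem (hh x hx).1
          rcases le_total s l with hls | hls
          · exact ⟨s, hs, hls, hsx⟩
          · exact ⟨l, c.ordConnected_dom.out (hh x hx).1 hs ⟨hl.le, hls⟩, le_rfl, hl⟩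
        have := hgx.eventually_lt_const (u := g l') (by
          change g x + 2 * Real.pi < g l'
          rw [← (hh x hx).2]; exact hgm (hh x hx).1 hl' hlx)
        filter_upwards [this, self_mem_nhdsWithin] with y hy hyI
        refine ((hlt _ (hh y hyI).1 _ hl').1 ?_).trans_le hll'
        rw [(hh y hyI).2]; exact hy
    have hch : ∀ x ∈ Set.Ioo p r, c.toFun (h x) = c.toFun x := fun x hx =>
      (hiff _ (hh x hx).1 _ (hpr hx)).2 ⟨1, by rw [(hh x hx).2]; simp⟩
    have hmem : t₁ ∈ Set.Ioo p r := ⟨hp1, hr1⟩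
    have hht : h t₁ = t₂ := hgm.injOn (hh t₁ hmem).1 h2 (by rw [(hh t₁ hmem).2, h12])
    filter_upwards [isOpen_Ioo.mem_nhds hmem] with t ht
    have := sub_eq_sub_of_unit_speed
      (fun x hx => ⟨_, c.hasDerivAt (hpr hx), c.unit_speed x (hpr hx)⟩)
      (fun x hx => ⟨_, c.hasDerivAt (hh x hx).1, c.unit_speed _ (hh x hx).1⟩) hm hhc hch hmem ht
    rw [hht] at this
    rw [← hch t ht]
    congr 1
    linarith

/-- A simple closed solution extends to a periodic solution on the whole line. -/
theorem exists_isClosedSolution {f : ℝ → ℝ} (hsol : c.IsSolution f) (hj : c.IsSimpleClosed) :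
    ∃ C u κ L, IsClosedSolution f C u κ L ∧ C 0 = c.toFun 0 ∧ u 0 = deriv c.toFun 0 := by
  obtain ⟨t₁, t₂, h10, h02, hsub, hinj, hnear⟩ := exists_turn hj
  obtain ⟨θ, ⟨hθs, hθ⟩, hκθ⟩ := hsol
  set L := t₂ - t₁ with hL
  have hL0 : 0 < L := by linarith
  set C : ℝ → ℂ := fun t => c.toFun (toIcoMod hL0 t₁ t) with hC
  have hCper : Function.Periodic C L := fun t => by simp [hC]
  have hCeq : ∀ t ∈ Set.Ico t₁ t₂, C t = c.toFun t := fun t ht => by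
    simp only [hC]
    rw [(toIcoMod_eq_self hL0).2 (by rwa [hL, add_sub_cancel])]
  have hmod : ∀ t, toIcoMod hL0 t₁ t ∈ Set.Ico t₁ t₂ := fun t => by
    have := toIcoMod_mem_Ico hL0 t₁ t
    exact ⟨this.1, this.2.trans_eq (by rw [hL]; ring)⟩
  have hloc : ∀ t ∈ Set.Ico t₁ t₂, C =ᶠ[nhds t] c.toFun := by
    intro t ht
    rcases eq_or_lt_of_le ht.1 with rfl | hlt
    · filter_upwards [hnear, Ioo_mem_nhds (show t₁ - L < t₁ by linarith)
        (show t₁ < t₂ by linarith)] with s hs hsI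
      rcases le_or_gt t₁ s with hle | hlt
      · exact hCeq s ⟨hle, hsI.2⟩
      · rw [← hCper, hCeq _ ⟨by linarith [hsI.1], by linarith⟩, hs]
    · filter_upwards [Ioo_mem_nhds hlt ht.2] with s hs
      exact hCeq s ⟨hs.1.le, hs.2⟩
  have hglob : ∀ t, ∃ a, t + a ∈ Set.Ico t₁ t₂ ∧ C =ᶠ[nhds t] fun s => c.toFun (s + a) := by
    intro t
    have ha : toIcoMod hL0 t₁ t = t + -(toIcoDiv hL0 t₁ t • L) := by
      rw [← sub_eq_add_neg]; rfl
    refine ⟨-(toIcoDiv hL0 t₁ t • L), ha ▸ hmod t, ?_⟩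
    have h1 := hloc _ (hmod t)
    rw [ha] at h1
    have h2 : Filter.Tendsto (fun s => s + -(toIcoDiv hL0 t₁ t • L)) (nhds t)
        (nhds (t + -(toIcoDiv hL0 t₁ t • L))) := (continuous_add_const _).tendsto t
    filter_upwards [h2.eventually h1] with s hs
    rw [← hs, ← sub_eq_add_neg, hCper.sub_zsmul_eq]
  have hIco : Set.Ico t₁ t₂ ⊆ c.dom := Set.Ico_subset_Icc_self.trans hsub
  have hCs : ContDiff ℝ ∞ C := by
    rw [contDiff_iff_contDiffAt]
    intro t
    obtain ⟨a, ha, hCa⟩ := hglob t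
    refine ContDiffAt.congr_of_eventuallyEq ?_ hCa
    exact ContDiffAt.comp t (g := c.toFun) (f := fun s => s + a) (c.contDiffAt (hIco ha))
      (contDiffAt_id.add contDiffAt_const)
  have hus : ContDiff ℝ ∞ (deriv C) := (contDiff_infty_iff_deriv.1 hCs).2
  have hvs : ContDiff ℝ ∞ (deriv (deriv C)) := (contDiff_infty_iff_deriv.1 hus).2
  set κ : ℝ → ℝ := fun t => ((starRingEnd ℂ) (deriv C t) * deriv (deriv C) t).im with hκ
  have htan : ∀ t, ∃ a, t + a ∈ c.dom ∧ C t = c.toFun (t + a) ∧ ‖deriv C t‖ = 1 ∧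
      HasDerivAt (deriv C) (Complex.I * ((deriv θ (t + a) : ℝ) : ℂ) * deriv C t) t := by
    intro t
    obtain ⟨a, ha, hCa⟩ := hglob t
    have hm := hIco ha
    have hev : deriv C =ᶠ[nhds t] fun s => Complex.exp (Complex.I * (θ (s + a) : ℂ)) := by
      have h1 : ∀ᶠ s in nhds t, s + a ∈ c.dom :=
        ((continuous_add_const a).tendsto t).eventually (c.isOpen_dom.mem_nhds hm)
      filter_upwards [hCa.deriv, h1] with s hs hsa
      rw [hs, deriv_comp_add_const, hθ _ hsa]
    have hθd : HasDerivAt θ (deriv θ (t + a)) (t + a) :=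
      ((hθs.contDiffAt (c.isOpen_dom.mem_nhds hm)).differentiableAt (by simp)).hasDerivAt
    have h2 : HasDerivAt (fun s => Complex.I * (θ (s + a) : ℂ))
        (Complex.I * ((deriv θ (t + a) : ℝ) : ℂ)) t :=
      ((hθd.comp_add_const t a).ofReal_comp).const_mul _
    refine ⟨a, hm, hCa.self_of_nhds, ?_, ?_⟩
    · rw [hev.self_of_nhds, norm_exp_I_mul]
    · refine (h2.cexp.congr_of_eventuallyEq hev).congr_deriv ?_
      rw [hev.self_of_nhds]
      ring
  have hκval : ∀ {t k : ℝ}, ‖deriv C t‖ = 1 →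
      HasDerivAt (deriv C) (Complex.I * (k : ℂ) * deriv C t) t → κ t = k := by
    intro t k hn hd
    have h1 : deriv C t * (starRingEnd ℂ) (deriv C t) = 1 := by
      rw [Complex.mul_conj, Complex.normSq_eq_norm_sq, hn]; simp
    have h2 : (starRingEnd ℂ) (deriv C t) * deriv (deriv C) t = Complex.I * (k : ℂ) := by
      rw [hd.deriv]; linear_combination Complex.I * (k : ℂ) * h1
    simp only [hκ]
    rw [h2]
    simp
  refine ⟨C, deriv C, κ, L, ⟨⟨fun t => (hCs.differentiable (by simp) t).hasDerivAt, fun t => ?_,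
    fun t => ?_, ?_, fun t ht => ?_⟩, hL0, hCper, fun s t hst => ?_⟩, ?_, ?_⟩
  · obtain ⟨a, -, -, hn, hd⟩ := htan t
    rw [hκval hn hd]
    exact hd
  · obtain ⟨a, -, -, hn, -⟩ := htan t
    exact hn
  · have h1 : ContDiff ℝ ∞ fun t => (starRingEnd ℂ) (deriv C t) * deriv (deriv C) t :=
      (Complex.conjCLE.contDiff.comp hus).mul hvs
    exact (Complex.imCLM.contDiff.comp h1).of_le (by simp)
  · obtain ⟨a, hm, hCa, hn, hd⟩ := htan t
    rw [hκval hn hd, hCa]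
    exact hκθ _ hm (by rwa [← hCa])
  · have h1 := hinj (hmod s) (hmod t) hst
    refine ⟨toIcoDiv hL0 t₁ t - toIcoDiv hL0 t₁ s, ?_⟩
    have h2 := toIcoMod_add_toIcoDiv_zsmul hL0 t₁ s
    have h3 := toIcoMod_add_toIcoDiv_zsmul hL0 t₁ t
    rw [zsmul_eq_mul] at h2 h3
    push_cast
    linarith
  · exact hCeq 0 ⟨h10, h02⟩
  · exact (hloc 0 ⟨h10, h02⟩).deriv_eq

end ArcPath

end CurvatureODE

/-! ### The net winding of a Jordan solution -/

theorem mainTheorem8 (f : ℝ → ℝ) (hf : ContDiffOn ℝ ∞ f (Set.Ioi 0))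
    (c : CurvatureODE.ArcPath) (hc : c.IsJordanSolution f) :
    (CurvatureODE.IsPeriodic f c.basePoint ∧
      IntervalIntegrable (fun t => f ‖CurvatureODE.flow f t c.basePoint‖) MeasureTheory.volume
        0 (CurvatureODE.period f c.basePoint)) ∧
    (c.IsUntwisted f → c.omega f = 0 ∨ ∃ n : ℕ, 0 < n ∧ c.omega f = 1 / (n : ℝ)) ∧
    (c.IsTwisted f → c.omega f = 1) := by
  obtain ⟨C, u, κ, L, h, hC0, hu0⟩ := CurvatureODE.ArcPath.exists_isClosedSolution hc.1.1 hc.2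
  have hp : c.basePoint = CurvatureODE.movingPath C u 0 := by
    rw [CurvatureODE.ArcPath.basePoint, CurvatureODE.movingPath, hC0, hu0]
  rw [CurvatureODE.ArcPath.IsUntwisted, CurvatureODE.ArcPath.IsTwisted,
    CurvatureODE.ArcPath.omega, hp]
  by_cases hconst : ∀ t, CurvatureODE.movingPath C u t = CurvatureODE.movingPath C u 0
  · obtain ⟨⟨hper, hT⟩, hω, hext⟩ := h.netWinding_of_constant hf hconst
    refine ⟨⟨hper, ?_⟩, fun _ => Or.inl hω, fun htw => absurd hext htw.2⟩
    rw [hT]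
  · obtain ⟨hper, n, hn, hω, htw⟩ := h.netWinding_of_not_constant hf hconst
    refine ⟨hper, fun _ => Or.inr ⟨n, hn, hω⟩, fun ht => ?_⟩
    rw [hω, htw ht.2]
    norm_num
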